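/- Setting. For $\gamma\in[-1,1]$ let $\phi_\gamma(x,y)=xy+\frac{\gamma}{3}y^3$, $\Sigma=[0,1]^2$, $N_\gamma(x,y)=(y,\,x+\gamma y^2,\,-1)$ (a normal to the graph of $\phi_\gamma$), and $$\mathcal E_\gamma f(\xi)=\int f(x,y)\,e^{i[\xi_1x+\xi_2y+\xi_3\phi_\gamma(x,y)]}\,dx\,dy,\qquad \xi\in\mathbb R^3 .$$ Let $0<\epsilon<10^{-10}$, $\delta=\epsilon^2$, $K=e^{\epsilon^{-10}}$, $R\ge1$, $B_R=[-R,R]^3$. Caps. For $\mu\ge1$, a cap is the intersection $\tau$ of $\Sigma$ with a closed axis-parallel square with center $z^c=(x^c,y^c)$ and side length in $[K^{-1},\mu^{1/2}K^{-1}]$. With $\mathbf t_z(z_1,z_2)=x_2-x_1+\gamma(y_1+y_2-y)(y_2-y_1)$, two caps $\tau_1,\tau_2$ are strongly separated if $$\min\big\{|y_2^c-y_1^c|,\ \max\{|\mathbf t_{z_1^c}(z_1^c,z_2^c)|,|\mathbf t_{z_2^c}(z_1^c,z_2^c)|\}\big\}\ge10\mu^{1/2}K^{-1}.$$ Tubes.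 Cover $\Sigma$ by the grid of squares $\theta$ of side length $R^{-1/2}$, with centers $\omega_\theta$; let $\nu(\theta)=N_\gamma(\omega_\theta)/|N_\gamma(\omega_\theta)|$. For every $\theta$ let $\mathbb T(\theta)$ be a finite family of tubes $T$ (solid cylinders) of radius $R^{1/2+\delta}$ and length $4R$, parallel to $\nu(T):=\nu(\theta)$ and centered on the plane $\nu(\theta)^\perp$, whose axes are $R^{1/2}$-separated and such that the tubes of radius $R^{1/2}$ with the same axes cover $B_R$. Let $\mathbb T=\bigcup_\theta\mathbb T(\theta)$. A dilate $sT$, $sB$ or $3\theta$ is taken about the center. Wave packets. A wave packet decomposition of $f\in L^2(\Sigma)$ with constant $A$ is a family $(f_T)_{T\in\mathbb T}$ in $L^2(\mathbb R^2)$ such that (a) $f_T$ vanishes off $3\theta$ if $T\in\mathbb T(\theta)$; (b) $|\mathcal E_\gamma f_T|\le R^{-1000}\|f\|_2$ on $B_R\setminus T$; (c) $|\mathcal E_\gamma f-\sum_{T}\mathcal E_\gamma f_T|\le R^{-1000}\|f\|_2$ on $B_R$; (d) $|\int f_{T_1}\overline{f_{T_2}}|\le R^{-1000}\int_{3\theta}|f|^2$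 if $T_1,T_2\in\mathbb T(\theta)$ are disjoint; (e) $\sum_{T\in\mathbb T(\theta)}\|f_T\|_2^2\le A\int_{3\theta}|f|^2$ for every $\theta$. Tangential tubes. Let $P$ be a real polynomial on $\mathbb R^3$ with zero set $Z(P)$ in which the nonsingular points (those with $\nabla P(\xi)\ne0$) are dense. Let $W$ be the $R^{1/2+\delta}$-neighborhood of $Z(P)$ and $B_j$ a ball of radius $R^{1-\delta}$. Let $\mathbb T_{j,tang}$ be the set of $T\in\mathbb T$ such that $T\cap W\cap B_j\ne\emptyset$ and $\mathrm{angle}(\nu(T),T_\xi Z(P))\le R^{-1/2+2\delta}$ for every nonsingular point $\xi\in Z(P)\cap2B_j\cap10T$. For an axis-parallel cube $Q$ of side length $R^{1/2}$, let $\mathbb T_{j,tang,Q}$ be the set of $T\in\mathbb T_{j,tang}$ such that $10T$ intersects $Q$. Statement. There is an absolute constant $C>0$ such that for every $\epsilon\in(0,10^{-10})$ and every $A$ there is $R_0=R_0(\epsilon,A)$ such that the following holds for all $R\ge R_0$, all $\gamma\in[-1,1]$, all $\mu\ge1$, and all tube families $\mathbb T$, polynomials $P$ and balls $B_j$ as above.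 Let $\tau_1,\tau_2$ be strongly separated caps, let $f_{\tau_1},f_{\tau_2}\in L^2$ vanish off $\tau_1$, $\tau_2$, let $(f_{\tau_i,T})_{T\in\mathbb T}$ be any wave packet decomposition of $f_{\tau_i}$ with constant $A$, and put $f_{\tau_i,j,tang}=\sum_{T\in\mathbb T_{j,tang}}f_{\tau_i,T}$ for $i=1,2$. Then for every axis-parallel cube $Q$ of side length $R^{1/2}$ that meets $B_j\cap W$, $$\int_{Q\cap B_R}|\mathcal E_\gamma f_{\tau_1,j,tang}|^2\,|\mathcal E_\gamma f_{\tau_2,j,tang}|^2\le R^{C\delta}R^{-1/2}\Big(\sum_{T_1\in\mathbb T_{j,tang,Q}}\|f_{\tau_1,T_1}\|_2^2\Big)\Big(\sum_{T_2\in\mathbb T_{j,tang,Q}}\|f_{\tau_2,T_2}\|_2^2\Big)+R^{-950}\|f_{\tau_1}\|_2^2\|f_{\tau_2}\|_2^2 .$$ -/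

import Mathlib

open MeasureTheory

noncomputable section

namespace SaddleExtension

/-- Physical space `ℝ³` with its Euclidean norm. -/
abbrev E3 := EuclideanSpace ℝ (Fin 3)

/-! ### The surface and the extension operator -/

/-- The unit square `Σ = [0,1] × [0,1]`. -/
def unitSquare : Set (ℝ × ℝ) := Set.Icc 0 1 ×ˢ Set.Icc 0 1

/-- `φ_γ(x,y) = xy + (γ/3) y³`. -/
def phase (γ : ℝ) (z : ℝ × ℝ) : ℝ := z.1 * z.2 + γ / 3 * z.2 ^ 3

/-- The downward normal `(∇φ_γ(z), -1)` to the graph of `φ_γ` over `z`; here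
`∇φ_γ(x,y) = (y, x + γ y²)`. -/
def normal (γ : ℝ) (z : ℝ × ℝ) : E3 := !₂[z.2, z.1 + γ * z.2 ^ 2, -1]

/-- The downward unit normal. -/
def unitNormal (γ : ℝ) (z : ℝ × ℝ) : E3 := ‖normal γ z‖⁻¹ • normal γ z

/-- The extension operator
`E_γ f(ξ) = ∫ f(x,y) exp(i(ξ₁ x + ξ₂ y + ξ₃ φ_γ(x,y))) dx dy`.
For `f` vanishing outside `Σ` this is the integral over `Σ`; wave packets belonging to squares
at the boundary of `Σ` may live slightly outside `Σ`. -/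
def extension (γ : ℝ) (f : ℝ × ℝ → ℂ) (ξ : E3) : ℂ :=
  ∫ z : ℝ × ℝ, f z *
    Complex.exp (Complex.I * ((ξ 0 * z.1 + ξ 1 * z.2 + ξ 2 * phase γ z : ℝ) : ℂ))

/-- `‖f‖₂²`. -/
def sqNorm (f : ℝ × ℝ → ℂ) : ℝ := ∫ z : ℝ × ℝ, ‖f z‖ ^ 2

/-- The closed axis-parallel square with center `c` and side length `r`. -/
def square (c : ℝ × ℝ) (r : ℝ) : Set (ℝ × ℝ) :=
  {z | |z.1 - c.1| ≤ r / 2 ∧ |z.2 - c.2| ≤ r / 2}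

/-! ### Caps and strong separation -/

/-- The cap `τ` with center `c` and side length `r`: a square, truncated to `Σ`. -/
def cap (c : ℝ × ℝ) (r : ℝ) : Set (ℝ × ℝ) := square c r ∩ unitSquare

/-- `t^γ_z(z₁,z₂) = x₂ - x₁ + γ (y₁ + y₂ - y)(y₂ - y₁)`. -/
def transversality (γ : ℝ) (z z₁ z₂ : ℝ × ℝ) : ℝ :=
  z₂.1 - z₁.1 + γ * (z₁.2 + z₂.2 - z.2) * (z₂.2 - z₁.2)

/-- Strong separation of two caps with centers `c₁`, `c₂`. -/
def StronglySeparated (γ μ K : ℝ) (c₁ c₂ : ℝ × ℝ) : Prop :=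
  10 * μ ^ (1 / 2 : ℝ) * K⁻¹ ≤
    min |c₂.2 - c₁.2| (max |transversality γ c₁ c₁ c₂| |transversality γ c₂ c₁ c₂|)

/-- `K(ε) = exp(ε⁻¹⁰)`. -/
def capParameter (ε : ℝ) : ℝ := Real.exp ((ε ^ 10)⁻¹)

/-! ### The small squares `θ` and the tubes -/

/-- Index set of the grid of squares `θ` of side length `R^{-1/2}` covering `Σ`. -/
abbrev GridIndex (R : ℝ) := Fin ⌈R ^ (1 / 2 : ℝ)⌉₊ × Fin ⌈R ^ (1 / 2 : ℝ)⌉₊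

/-- The center `ω_θ`. -/
def gridCenter (R : ℝ) (θ : GridIndex R) : ℝ × ℝ :=
  (((θ.1 : ℕ) + 1 / 2 : ℝ) * R ^ (-(1 / 2) : ℝ), ((θ.2 : ℕ) + 1 / 2 : ℝ) * R ^ (-(1 / 2) : ℝ))

/-- The direction `ν(θ)`. -/
def gridNormal (γ R : ℝ) (θ : GridIndex R) : E3 := unitNormal γ (gridCenter R θ)

/-- The concentric dilate `3θ`. -/
def tripleSquare (R : ℝ) (θ : GridIndex R) : Set (ℝ × ℝ) :=
  square (gridCenter R θ) (3 * R ^ (-(1 / 2) : ℝ))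

/-- The cube `B_R = [-R,R]³`. -/
def bigCube (R : ℝ) : Set E3 := {ξ | ∀ i, |ξ i| ≤ R}

/-- The solid cylinder of radius `ρ` and length `ℓ` with center `a` and (unit) direction `ν`. -/
def cylinder (ν a : E3) (ρ ℓ : ℝ) : Set E3 :=
  {ξ | ‖ξ - a - inner ℝ ν (ξ - a) • ν‖ ≤ ρ ∧ |inner ℝ ν (ξ - a)| ≤ ℓ / 2}

/-- The families `𝕋(θ)`. The tubes of `𝕋(θ)` are parallel to `ν(θ)`; a tube is recorded by its
center, which is taken in the plane through the origin orthogonal to `ν(θ)`. The axes are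
`R^{1/2}`-separated, and the thin tubes of radius `R^{1/2}` with these axes cover `B_R`. The length
is `4R`, so that a tube runs through all of `B_R`. -/
structure TubeFamily (γ R : ℝ) where
  centers : GridIndex R → Finset E3
  orthogonal : ∀ θ, ∀ a ∈ centers θ, inner ℝ (gridNormal γ R θ) a = 0
  separated : ∀ θ, ∀ a ∈ centers θ, ∀ b ∈ centers θ, a ≠ b → R ^ (1 / 2 : ℝ) ≤ dist a b
  covers : ∀ θ, ∀ ξ ∈ bigCube R, ∃ a ∈ centers θ,
    ξ ∈ cylinder (gridNormal γ R θ) a (R ^ (1 / 2 : ℝ)) (4 * R)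

/-- A label of a tube: the square `θ` with `T ∈ 𝕋(θ)` and the center of `T`. -/
abbrev TubeIndex (R : ℝ) := Σ _ : GridIndex R, E3

/-- `𝕋`, the union of the `𝕋(θ)`. -/
def TubeFamily.tubes {γ R : ℝ} (𝕋 : TubeFamily γ R) : Finset (TubeIndex R) :=
  Finset.univ.sigma 𝕋.centers

/-- The direction `ν(T)`. -/
def tubeDirection (γ : ℝ) {R : ℝ} (T : TubeIndex R) : E3 := gridNormal γ R T.1

/-- `sT`, the dilate by the factor `s` about its center of the tube `T` of radius `R^{1/2+δ}` and
length `4R`. -/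
def dilatedTube (γ δ s : ℝ) {R : ℝ} (T : TubeIndex R) : Set E3 :=
  cylinder (tubeDirection γ T) T.2 (s * R ^ (1 / 2 + δ : ℝ)) (s * (4 * R))

/-- The tube `T`. -/
def tube (γ δ : ℝ) {R : ℝ} (T : TubeIndex R) : Set E3 := dilatedTube γ δ 1 T

/-! ### Wave packet decompositions -/

/-- `(f_T)_{T ∈ 𝕋}` is a wave packet decomposition of `f ∈ L²`, with constant `A` in the
square function bound. -/
structure IsWavePacketDecomposition {γ R : ℝ} (δ A : ℝ) (𝕋 : TubeFamily γ R)
    (f : ℝ × ℝ → ℂ) (fT : TubeIndex R → ℝ × ℝ → ℂ) : Prop where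
  memLp : ∀ T ∈ 𝕋.tubes, MemLp (fT T) 2 volume
  support : ∀ T ∈ 𝕋.tubes, ∀ z ∉ tripleSquare R T.1, fT T z = 0
  decay : ∀ T ∈ 𝕋.tubes, ∀ ξ ∈ bigCube R \ tube γ δ T,
    ‖extension γ (fT T) ξ‖ ≤ R ^ (-1000 : ℝ) * √(sqNorm f)
  approx : ∀ ξ ∈ bigCube R,
    ‖extension γ f ξ - ∑ T ∈ 𝕋.tubes, extension γ (fT T) ξ‖ ≤ R ^ (-1000 : ℝ) * √(sqNorm f)
  almost_orthogonal : ∀ T₁ ∈ 𝕋.tubes, ∀ T₂ ∈ 𝕋.tubes, T₁.1 = T₂.1 →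
    Disjoint (tube γ δ T₁) (tube γ δ T₂) →
      ‖∫ z : ℝ × ℝ, fT T₁ z * starRingEnd ℂ (fT T₂ z)‖ ≤
        R ^ (-1000 : ℝ) * ∫ z in tripleSquare R T₁.1, ‖f z‖ ^ 2
  square_sum : ∀ θ : GridIndex R,
    ∑ a ∈ 𝕋.centers θ, sqNorm (fT ⟨θ, a⟩) ≤ A * ∫ z in tripleSquare R θ, ‖f z‖ ^ 2

/-! ### The variety `Z(P)` and tangential tubes -/

/-- `Z(P)`. -/
def zeroSet (P : MvPolynomial (Fin 3) ℝ) : Set E3 := {ξ | MvPolynomial.eval (fun i => ξ i) P = 0}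

/-- `∇P(ξ)`. -/
def polyGradient (P : MvPolynomial (Fin 3) ℝ) (ξ : E3) : E3 :=
  WithLp.toLp 2 fun i => MvPolynomial.eval (fun k => ξ k) (MvPolynomial.pderiv i P)

/-- The nonsingular points of `Z(P)`. -/
def nonsingularPoints (P : MvPolynomial (Fin 3) ℝ) : Set E3 :=
  {ξ | ξ ∈ zeroSet P ∧ polyGradient P ξ ≠ 0}

/-- The angle in `[0, π/2]` between the vector `v` and the tangent plane
`T_ξ Z(P) = (∇P(ξ))^⊥` at a nonsingular point `ξ`. -/
def angleToTangentPlane (P : MvPolynomial (Fin 3) ℝ) (v ξ : E3) : ℝ :=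
  |Real.pi / 2 - InnerProductGeometry.angle v (polyGradient P ξ)|

/-- `W`, the `R^{1/2+δ}`-neighborhood of `Z(P)`. -/
def wall (R δ : ℝ) (P : MvPolynomial (Fin 3) ℝ) : Set E3 :=
  Metric.thickening (R ^ (1 / 2 + δ : ℝ)) (zeroSet P)

/-- `sB_j`, where `B_j` is the ball of radius `R^{1-δ}` with center `b`. -/
def dilatedBall (R δ s : ℝ) (b : E3) : Set E3 := Metric.closedBall b (s * R ^ (1 - δ : ℝ))

/-- The ball `B_j`. -/
def smallBall (R δ : ℝ) (b : E3) : Set E3 := dilatedBall R δ 1 b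

/-- The closed axis-parallel cube of side length `R^{1/2}` with center `q`. -/
def smallCube (R : ℝ) (q : E3) : Set E3 := {ξ | ∀ i, |ξ i - q i| ≤ R ^ (1 / 2 : ℝ) / 2}

/-- The condition that `T` is tangential to `Z(P)` in the ball `B_j` with center `b`. -/
def IsTangential (γ δ : ℝ) {R : ℝ} (P : MvPolynomial (Fin 3) ℝ) (b : E3) (T : TubeIndex R) :
    Prop :=
  (tube γ δ T ∩ wall R δ P ∩ smallBall R δ b).Nonempty ∧
    ∀ ξ ∈ nonsingularPoints P, ξ ∈ dilatedBall R δ 2 b ∩ dilatedTube γ δ 10 T →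
      angleToTangentPlane P (tubeDirection γ T) ξ ≤ R ^ (-(1 / 2) + 2 * δ : ℝ)

open Classical in
/-- `𝕋_{j,tang}`. -/
def tangTubes {γ R : ℝ} (δ : ℝ) (𝕋 : TubeFamily γ R) (P : MvPolynomial (Fin 3) ℝ) (b : E3) :
    Finset (TubeIndex R) :=
  𝕋.tubes.filter fun T => IsTangential γ δ P b T

open Classical in
/-- `𝕋_{j,tang,Q}`: the `T ∈ 𝕋_{j,tang}` such that `10T` intersects the cube `Q` with
center `q`. -/
def tangTubesAt {γ R : ℝ} (δ : ℝ) (𝕋 : TubeFamily γ R) (P : MvPolynomial (Fin 3) ℝ) (b q : E3) :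
    Finset (TubeIndex R) :=
  (tangTubes δ 𝕋 P b).filter fun T => (dilatedTube γ δ 10 T ∩ smallCube R q).Nonempty

/-- `f_{j,tang} = ∑_{T ∈ 𝕋_{j,tang}} f_T`. -/
def tangPart {γ R : ℝ} (δ : ℝ) (𝕋 : TubeFamily γ R) (P : MvPolynomial (Fin 3) ℝ) (b : E3)
    (fT : TubeIndex R → ℝ × ℝ → ℂ) (z : ℝ × ℝ) : ℂ :=
  ∑ T ∈ tangTubes δ 𝕋 P b, fT T z

end SaddleExtension

end

noncomputable section

namespace SaddleExtension

/-! ### Gaussian-weighted `L²` bounds for oscillatory integrals -/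

section Gaussian

variable {X : Type*} [MeasurableSpace X] {m : Measure X}

/-! The tubes that matter on `Q` have directions almost in one plane. Let `n` be the unit normal of
`Z(P)` at a nonsingular point near `Q`. Tangency gives `|ν(T) · n| ≤ ρ = R^(-1/2+2δ)` for every
tangential tube `T` meeting `Q` (`exists_common_normal`), and the other packets are negligible on
`Q`. As `ν(T)` is parallel to `(y, x + γy², -1)`, the remaining frequencies lie in a strip `n₁ y +
n₂ (x + γy²) - n₃ = O(ρ)`.

The product of the two extensions is an oscillatory integral over pairs `w = (z₁, z₂)` with
frequency map `Ψ(w) = Φ(z₁) + Φ(z₂)`, where `Φ` is `surfacePoint`. Weighting its square by a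
Gaussian of width `R^(1/2)` centered at `Q` produces `R^(3/2) ∬ |F(w)| |F(w')| exp(-R |Ψ(w) -
Ψ(w')|² / 4)` up to a constant, `F` being the tensor product of the two amplitudes. If `Ψ`
determines `w` up to `O(ρ)` on the supports, Schur's test in four dimensions bounds this by `R^(3/2)
ρ⁴ ‖F‖² = R^(-1/2+8δ) ‖F‖²`, plus a rapidly small tail (`integral_extension_mul_sq_le`).

The geometric core is this injectivity (`curve_rigidity`, `strip_rigidity`). Separation in `y`
forces `|n₂| ≥ κ/20`, with `κ = 1/K`, so the strip is a neighborhood of a curve `x = ay + b - γy²`.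
On that curve `φ_γ = ay² + by - (2/3)γy³`. Write `Δ` and `D` for the differences of the sums of `y`
and of `y²` over the two pairs. The first two coordinates of `Ψ` make `Δ` and then `γD` small; the
third makes `aD` small. Transversality says `|a| + |γ| ≳ κ`, so `D` is small. Sum and sum of squares
determine a pair up to order, and separation in `y` excludes the swap.

Finally `‖F_i‖²` is at most `R^(O(δ)) ∑ ‖f_T‖²`, because at each frequency only `O(R^(3δ))` packets
through `Q` are nonzero (`card_overlap_le`). Powers of `K` are absorbed by `R^δ` for large `R`. -/

/-- Absolute integrability on the product space justifies Fubini below: the Gaussian is integrable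
in `ξ` and `f ⊗ f̄` is integrable on pairs. -/
theorem integrable_gaussian_kernel {f : X → ℂ} (hf : Integrable f m) {Φ : X → E3}
    (hΦ : Measurable Φ) {b : ℝ} (hb : 0 < b) :
    Integrable (fun u : E3 × (X × X) =>
      Complex.exp (-(b : ℂ) * ‖u.1‖ ^ 2 + Complex.I * (inner ℝ (Φ u.2.1 - Φ u.2.2) u.1 : ℝ)) *
        (f u.2.1 * starRingEnd ℂ (f u.2.2))) (volume.prod (m.prod m)) := by
  have hconj : Integrable (fun w => starRingEnd ℂ (f w)) m :=
    (RCLike.conjLIE (K := ℂ)).toContinuousLinearEquiv.toContinuousLinearMap.integrable_comp hf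
  have hff := hf.mul_prod hconj
  have hg : Integrable (fun v : E3 => Complex.exp (-(b : ℂ) * ‖v‖ ^ 2)) volume := by
    simpa using GaussianFourier.integrable_cexp_neg_mul_sq_norm_add (V := E3)
      (b := (b : ℂ)) (by simpa using hb) 0 0
  refine (hg.mul_prod hff).mono ?_ ?_
  · refine AEStronglyMeasurable.mul ?_ hff.1.comp_snd
    refine Measurable.aestronglyMeasurable ?_
    have h1 : Measurable fun u : E3 × (X × X) => (inner ℝ (Φ u.2.1 - Φ u.2.2) u.1 : ℝ) :=
      ((hΦ.comp (measurable_fst.comp measurable_snd)).sub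
        (hΦ.comp (measurable_snd.comp measurable_snd))).inner measurable_fst
    have h2 : Measurable fun u : E3 × (X × X) => ‖u.1‖ := measurable_fst.norm
    fun_prop
  · refine Filter.Eventually.of_forall fun u => le_of_eq ?_
    rw [norm_mul, norm_mul (Complex.exp _), Complex.norm_exp, Complex.norm_exp]
    congr 2
    simp

variable [SFinite m]

theorem integral_gaussian_kernel {f : X → ℂ} {Φ : X → E3} {b : ℝ} (ξ : E3) :
    ∫ p : X × X, Complex.exp (-(b : ℂ) * ‖ξ‖ ^ 2 +
        Complex.I * (inner ℝ (Φ p.1 - Φ p.2) ξ : ℝ)) *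
        (f p.1 * starRingEnd ℂ (f p.2)) ∂m.prod m =
      ((Real.exp (-b * ‖ξ‖ ^ 2) *
        ‖∫ w, f w * Complex.exp (Complex.I * (inner ℝ (Φ w) ξ : ℝ)) ∂m‖ ^ 2 : ℝ) : ℂ) := by
  have h : ∀ p : X × X, Complex.exp (-(b : ℂ) * ‖ξ‖ ^ 2 +
        Complex.I * (inner ℝ (Φ p.1 - Φ p.2) ξ : ℝ)) * (f p.1 * starRingEnd ℂ (f p.2)) =
      (Real.exp (-b * ‖ξ‖ ^ 2) : ℂ) *
      ((f p.1 * Complex.exp (Complex.I * (inner ℝ (Φ p.1) ξ : ℝ))) *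
        starRingEnd ℂ (f p.2 * Complex.exp (Complex.I * (inner ℝ (Φ p.2) ξ : ℝ)))) := by
    intro p
    rw [map_mul, ← Complex.exp_conj, map_mul, Complex.conj_I, Complex.conj_ofReal,
      inner_sub_left, Complex.ofReal_sub]
    have : Complex.exp (-(b : ℂ) * ‖ξ‖ ^ 2 + Complex.I * ((inner ℝ (Φ p.1) ξ : ℝ) -
        (inner ℝ (Φ p.2) ξ : ℝ))) = Complex.exp (-(b : ℂ) * ‖ξ‖ ^ 2) *
        (Complex.exp (Complex.I * (inner ℝ (Φ p.1) ξ : ℝ)) *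
          Complex.exp (-Complex.I * (inner ℝ (Φ p.2) ξ : ℝ))) := by
      rw [← Complex.exp_add, ← Complex.exp_add]; congr 1; ring
    rw [this]
    push_cast
    ring
  simp_rw [h]
  rw [integral_const_mul, integral_prod_mul
    (fun w => f w * Complex.exp (Complex.I * (inner ℝ (Φ w) ξ : ℝ)))
    (fun w => starRingEnd ℂ (f w * Complex.exp (Complex.I * (inner ℝ (Φ w) ξ : ℝ)))),
    integral_conj, Complex.mul_conj, Complex.normSq_eq_norm_sq]
  push_cast
  rfl

theorem integrable_gaussian_mul_sq {f : X → ℂ} (hf : Integrable f m) {Φ : X → E3}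
    (hΦ : Measurable Φ) {b : ℝ} (hb : 0 < b) :
    Integrable (fun ξ : E3 => Real.exp (-b * ‖ξ‖ ^ 2) *
        ‖∫ w, f w * Complex.exp (Complex.I * (inner ℝ (Φ w) ξ : ℝ)) ∂m‖ ^ 2) := by
  have h := (integrable_gaussian_kernel hf hΦ hb).integral_prod_left
  simp_rw [integral_gaussian_kernel] at h
  refine h.re.congr (Filter.Eventually.of_forall fun ξ => ?_)
  exact Complex.ofReal_re _

/-- Expand the square and integrate in `ξ` first. The Fourier transform of the Gaussian is a
positive Gaussian, so all oscillation turns into concentration of the kernel on `|Φ(w) - Φ(w')| ≲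
√b`. -/
theorem integral_gaussian_mul_sq_le {f : X → ℂ} (hf : Integrable f m) {Φ : X → E3}
    (hΦ : Measurable Φ) {b : ℝ} (hb : 0 < b) :
    ∫ ξ : E3, Real.exp (-b * ‖ξ‖ ^ 2) *
        ‖∫ w, f w * Complex.exp (Complex.I * (inner ℝ (Φ w) ξ : ℝ)) ∂m‖ ^ 2 ≤
      (Real.pi / b) ^ (3 / 2 : ℝ) *
        ∫ p : X × X, ‖f p.1‖ * ‖f p.2‖ * Real.exp (-‖Φ p.1 - Φ p.2‖ ^ 2 / (4 * b)) ∂m.prod m := by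
  have hswap := integral_integral_swap (f := fun (ξ : E3) (p : X × X) =>
      Complex.exp (-(b : ℂ) * ‖ξ‖ ^ 2 + Complex.I * (inner ℝ (Φ p.1 - Φ p.2) ξ : ℝ)) *
        (f p.1 * starRingEnd ℂ (f p.2))) (integrable_gaussian_kernel hf hΦ hb)
  simp_rw [integral_gaussian_kernel] at hswap
  rw [integral_complex_ofReal] at hswap
  have hpb : 0 < Real.pi / b := by positivity
  have hin : ∀ p : X × X, ‖∫ ξ : E3, Complex.exp (-(b : ℂ) * ‖ξ‖ ^ 2 +
        Complex.I * (inner ℝ (Φ p.1 - Φ p.2) ξ : ℝ)) * (f p.1 * starRingEnd ℂ (f p.2))‖ =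
      (Real.pi / b) ^ (3 / 2 : ℝ) *
        (‖f p.1‖ * ‖f p.2‖ * Real.exp (-‖Φ p.1 - Φ p.2‖ ^ 2 / (4 * b))) := by
    intro p
    rw [integral_mul_const, GaussianFourier.integral_cexp_neg_mul_sq_norm_add
      (by simpa using hb)]
    have e : ((Module.finrank ℝ E3 : ℂ) / 2) = ((3 / 2 : ℝ) : ℂ) := by simp
    rw [e, ← Complex.ofReal_div, ← Complex.ofReal_cpow hpb.le, norm_mul, norm_mul, norm_mul,
      Complex.norm_real, Real.norm_of_nonneg (by positivity), RCLike.norm_conj]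
    have e2 : Complex.I ^ 2 * (‖Φ p.1 - Φ p.2‖ : ℂ) ^ 2 / (4 * (b : ℂ)) =
        ((-‖Φ p.1 - Φ p.2‖ ^ 2 / (4 * b) : ℝ) : ℂ) := by
      push_cast; rw [Complex.I_sq]; ring
    rw [e2, ← Complex.ofReal_exp, Complex.norm_real, Real.norm_of_nonneg (Real.exp_nonneg _)]
    ring
  calc _ ≤ ‖((∫ ξ : E3, Real.exp (-b * ‖ξ‖ ^ 2) *
        ‖∫ w, f w * Complex.exp (Complex.I * (inner ℝ (Φ w) ξ : ℝ)) ∂m‖ ^ 2 : ℝ) : ℂ)‖ := by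
        rw [Complex.norm_real]; exact Real.le_norm_self _
    _ ≤ _ := by
        rw [hswap, ← integral_const_mul]
        refine (norm_integral_le_integral_norm _).trans (le_of_eq ?_)
        simp_rw [hin]

end Gaussian

/-! ### A Schur test -/

/-- Schur's test for the kernel that is the indicator of the neighborhood `dist ≤ r` of the
diagonal. -/
theorem lintegral_near_diagonal_le {f : (ℝ × ℝ) × (ℝ × ℝ) → ℂ} (hf : AEStronglyMeasurable f volume)
    (r : ℝ) :
    ∫⁻ p : ((ℝ × ℝ) × (ℝ × ℝ)) × ((ℝ × ℝ) × (ℝ × ℝ)),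
      {p : ((ℝ × ℝ) × (ℝ × ℝ)) × ((ℝ × ℝ) × (ℝ × ℝ)) | dist p.1 p.2 ≤ r}.indicator
        (fun p => ‖f p.1‖ₑ * ‖f p.2‖ₑ) p ∂volume.prod volume ≤
      2 * ENNReal.ofReal (2 * r) ^ 4 * ∫⁻ w, ‖f w‖ₑ ^ 2 := by
  set D := {p : ((ℝ × ℝ) × (ℝ × ℝ)) × ((ℝ × ℝ) × (ℝ × ℝ)) | dist p.1 p.2 ≤ r} with hD
  have hDm : MeasurableSet D := (isClosed_le (by fun_prop) (by fun_prop)).measurableSet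
  -- Products carry the sup distance, so balls in four dimensions are cubes of side `2r`.
  have hvol : ∀ w : (ℝ × ℝ) × (ℝ × ℝ), volume (Metric.closedBall w r) =
      ENNReal.ofReal (2 * r) ^ 4 := by
    rintro ⟨⟨a, b⟩, ⟨c, d⟩⟩
    rw [← closedBall_prod_same, ← closedBall_prod_same, ← closedBall_prod_same]
    simp only [Measure.volume_eq_prod, Measure.prod_prod, Real.volume_closedBall]
    ring
  have hf2 : AEMeasurable (fun w => ‖f w‖ₑ ^ 2) volume := hf.enorm.pow_const 2
  have h1 : ∫⁻ p, D.indicator (fun p => ‖f p.1‖ₑ ^ 2) p ∂volume.prod volume =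
      ENNReal.ofReal (2 * r) ^ 4 * ∫⁻ w, ‖f w‖ₑ ^ 2 := by
    rw [lintegral_prod _ (hf2.comp_fst.indicator hDm), ← lintegral_const_mul'' _ hf2]
    refine lintegral_congr fun w => ?_
    have : ∀ w', D.indicator (fun p => ‖f p.1‖ₑ ^ 2) (w, w') =
        (Metric.closedBall w r).indicator (fun _ => ‖f w‖ₑ ^ 2) w' := by
      intro w'
      simp only [Set.indicator, hD, Set.mem_ofPred_eq, Metric.mem_closedBall, dist_comm]
    simp_rw [this]
    rw [lintegral_indicator_const measurableSet_closedBall, hvol, mul_comm]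
  have h2 : ∫⁻ p, D.indicator (fun p => ‖f p.2‖ₑ ^ 2) p ∂volume.prod volume =
      ENNReal.ofReal (2 * r) ^ 4 * ∫⁻ w, ‖f w‖ₑ ^ 2 := by
    rw [lintegral_prod_symm _ (hf2.comp_snd.indicator hDm), ← lintegral_const_mul'' _ hf2]
    refine lintegral_congr fun w => ?_
    have : ∀ w', D.indicator (fun p => ‖f p.2‖ₑ ^ 2) (w', w) =
        (Metric.closedBall w r).indicator (fun _ => ‖f w‖ₑ ^ 2) w' := by
      intro w'
      simp only [Set.indicator, hD, Set.mem_ofPred_eq, Metric.mem_closedBall]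
    simp_rw [this]
    rw [lintegral_indicator_const measurableSet_closedBall, hvol, mul_comm]
  calc _ ≤ ∫⁻ p, (D.indicator (fun p => ‖f p.1‖ₑ ^ 2) p +
        D.indicator (fun p => ‖f p.2‖ₑ ^ 2) p) ∂volume.prod volume := by
        refine lintegral_mono fun p => ?_
        simp only [Set.indicator]
        split_ifs
        · rcases le_total ‖f p.1‖ₑ ‖f p.2‖ₑ with h | h
          · exact le_add_left (by rw [sq]; gcongr)
          · exact le_add_right (by rw [sq]; gcongr)
        · simp
    _ = _ := by
        rw [lintegral_add_left' (hf2.comp_fst.indicator hDm), h1, h2]; ring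

/-- The kernel is split into a near-diagonal part, where it is at most 1, and a tail of size at most
`η`. The tail is again a near-diagonal kernel, of radius 4, because the support has diameter at most
4; hence the factor `8 ^ 4`. -/
theorem integral_schur_le {f : (ℝ × ℝ) × (ℝ × ℝ) → ℂ} (hf : MemLp f 2 volume)
    {k : ((ℝ × ℝ) × (ℝ × ℝ)) × ((ℝ × ℝ) × (ℝ × ℝ)) → ℝ} (hkm : Measurable k) (hk0 : ∀ p, 0 ≤ k p)
    (hk1 : ∀ p, k p ≤ 1) {r η : ℝ} (hr : 0 ≤ r) (hη : 0 ≤ η)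
    (hk : ∀ p, f p.1 ≠ 0 → f p.2 ≠ 0 → dist p.1 p.2 ≤ r ∨ (dist p.1 p.2 ≤ 4 ∧ k p ≤ η)) :
    ∫ p, ‖f p.1‖ * ‖f p.2‖ * k p ∂volume.prod volume ≤
      2 * ((2 * r) ^ 4 + 8 ^ 4 * η) * ∫ w, ‖f w‖ ^ 2 := by
  set S := ∫⁻ w, ‖f w‖ₑ ^ 2 with hS
  have hS' : ∫ w, ‖f w‖ ^ 2 = S.toReal := by
    rw [integral_eq_lintegral_of_nonneg_ae (Filter.Eventually.of_forall fun _ => by positivity)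
      ((hf.1.norm.aemeasurable.pow_const 2).aestronglyMeasurable)]
    congr 1
    refine lintegral_congr fun w => ?_
    rw [ENNReal.ofReal_pow (norm_nonneg _), ofReal_norm]
  have hSfin : S ≠ ⊤ := by
    have := hf.integrable_norm_pow (by norm_num)
    have h2 := this.2
    rw [hasFiniteIntegral_iff_enorm] at h2
    refine ne_of_lt (lt_of_le_of_lt (le_of_eq ?_) h2)
    refine lintegral_congr fun w => ?_
    simp [enorm_pow]
  have key : ∫⁻ p, ENNReal.ofReal (‖f p.1‖ * ‖f p.2‖ * k p) ∂volume.prod volume ≤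
      ENNReal.ofReal (2 * ((2 * r) ^ 4 + 8 ^ 4 * η)) * S := by
    set g : ((ℝ × ℝ) × (ℝ × ℝ)) × ((ℝ × ℝ) × (ℝ × ℝ)) → ENNReal := fun p => ‖f p.1‖ₑ * ‖f p.2‖ₑ
    have hg : AEMeasurable g (volume.prod volume) := hf.1.enorm.comp_fst.mul hf.1.enorm.comp_snd
    have hDm : ∀ r : ℝ, MeasurableSet
        {p : ((ℝ × ℝ) × (ℝ × ℝ)) × ((ℝ × ℝ) × (ℝ × ℝ)) | dist p.1 p.2 ≤ r} := fun r =>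
      (isClosed_le (by fun_prop) (by fun_prop)).measurableSet
    calc _ ≤ ∫⁻ p, ({p : ((ℝ × ℝ) × (ℝ × ℝ)) × ((ℝ × ℝ) × (ℝ × ℝ)) | dist p.1 p.2 ≤ r}.indicator g p
          + ENNReal.ofReal η * {p : ((ℝ × ℝ) × (ℝ × ℝ)) × ((ℝ × ℝ) × (ℝ × ℝ)) |
              dist p.1 p.2 ≤ 4}.indicator g p) ∂volume.prod volume := by
          refine lintegral_mono fun p => ?_
          have hfac : ENNReal.ofReal (‖f p.1‖ * ‖f p.2‖ * k p) = g p * ENNReal.ofReal (k p) := by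
            rw [ENNReal.ofReal_mul (by positivity), ENNReal.ofReal_mul (by positivity),
              ofReal_norm, ofReal_norm]
          simp only
          rw [hfac]
          by_cases h0 : f p.1 = 0
          · simp [g, h0]
          by_cases h0' : f p.2 = 0
          · simp [g, h0']
          rcases hk p h0 h0' with h | ⟨h, h'⟩
          · refine le_add_right ?_
            rw [Set.indicator_of_mem (by exact h)]
            calc g p * ENNReal.ofReal (k p) ≤ g p * 1 := by
                  gcongr; simpa using hk1 p
              _ = g p := mul_one _
          · refine le_add_left ?_
            rw [Set.indicator_of_mem (by exact h), mul_comm]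
            gcongr
      _ ≤ 2 * ENNReal.ofReal (2 * r) ^ 4 * S +
          ENNReal.ofReal η * (2 * ENNReal.ofReal (2 * 4) ^ 4 * S) := by
          rw [lintegral_add_left' (hg.indicator (hDm r)),
            lintegral_const_mul'' _ (hg.indicator (hDm 4))]
          gcongr
          · exact lintegral_near_diagonal_le hf.1 r
          · exact lintegral_near_diagonal_le hf.1 4
      _ = _ := by
          have h2r : 0 ≤ 2 * r := by positivity
          generalize 2 * r = u at h2r
          rw [show (2 * 4 : ℝ) = 8 by norm_num, ENNReal.ofReal_mul (p := 2) (by norm_num),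
            ENNReal.ofReal_add (by positivity) (by positivity), ENNReal.ofReal_pow (by positivity),
            ENNReal.ofReal_mul (p := 8 ^ 4) (by norm_num), ENNReal.ofReal_pow (by norm_num)]
          simp only [ENNReal.ofReal_ofNat]
          ring
  rw [hS', integral_eq_lintegral_of_nonneg_ae (Filter.Eventually.of_forall fun p =>
    mul_nonneg (by positivity) (hk0 p))]
  · have := ENNReal.toReal_mono (ENNReal.mul_ne_top ENNReal.ofReal_ne_top hSfin) key
    rwa [ENNReal.toReal_mul, ENNReal.toReal_ofReal (by positivity)] at this
  · exact (hf.1.norm.comp_fst.mul hf.1.norm.comp_snd).mul hkm.aestronglyMeasurable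

/-! ### The product of two extensions on a small cube -/

/-- The point of the graph of `φ_γ` over `z`. -/
def surfacePoint (γ : ℝ) (z : ℝ × ℝ) : E3 := !₂[z.1, z.2, phase γ z]

theorem inner_surfacePoint (γ : ℝ) (z : ℝ × ℝ) (ξ : E3) :
    (inner ℝ (surfacePoint γ z) ξ : ℝ) = ξ 0 * z.1 + ξ 1 * z.2 + ξ 2 * phase γ z := by
  simp [surfacePoint, PiLp.inner_apply, Fin.sum_univ_three]

theorem measurable_surfacePoint (γ : ℝ) : Measurable (surfacePoint γ) := by
  refine Continuous.measurable ?_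
  refine (PiLp.continuous_toLp 2 _).comp (continuous_pi fun i => ?_)
  fin_cases i
  · simpa using continuous_fst
  · simpa using continuous_snd
  · simp only [phase]
    change Continuous fun z : ℝ × ℝ => z.1 * z.2 + γ / 3 * z.2 ^ 3
    fun_prop

/-- The translation by `q` only multiplies the amplitude by a unimodular factor, so the Gaussian
weight may be centered at the origin. -/
theorem extension_mul_extension (γ : ℝ) (F₁ F₂ : ℝ × ℝ → ℂ) (q ξ : E3) :
    extension γ F₁ (ξ + q) * extension γ F₂ (ξ + q) =
      ∫ w : (ℝ × ℝ) × (ℝ × ℝ), (F₁ w.1 * F₂ w.2 * Complex.exp (Complex.I *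
        (inner ℝ (surfacePoint γ w.1 + surfacePoint γ w.2) q : ℝ))) *
        Complex.exp (Complex.I * (inner ℝ (surfacePoint γ w.1 + surfacePoint γ w.2) ξ : ℝ)) := by
  simp only [extension, ← inner_surfacePoint]
  rw [Measure.volume_eq_prod (ℝ × ℝ) (ℝ × ℝ), ← integral_prod_mul]
  refine integral_congr_ae (Filter.Eventually.of_forall fun w => ?_)
  simp only [inner_add_left, inner_add_right, Complex.ofReal_add, mul_add, Complex.exp_add]
  ring

theorem exp_neg_norm_sq_ge_of_mem_smallCube {R : ℝ} (hR : 0 < R) {q ξ : E3}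
    (h : ξ ∈ smallCube R q) : 1 ≤ 3 * Real.exp (-R⁻¹ * ‖ξ - q‖ ^ 2) := by
  have hs : (R ^ (1 / 2 : ℝ)) ^ 2 = R := by
    rw [← Real.rpow_natCast, ← Real.rpow_mul hR.le]; norm_num
  have hc : ∀ i, (ξ i - q i) ^ 2 ≤ R / 4 := fun i => by
    have := sq_le_sq' (abs_le.1 (h i)).1 (abs_le.1 (h i)).2
    rwa [div_pow, hs, show (2 : ℝ) ^ 2 = 4 by norm_num] at this
  have hn : ‖ξ - q‖ ^ 2 ≤ R := by
    rw [EuclideanSpace.norm_sq_eq, Fin.sum_univ_three]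
    simp only [PiLp.sub_apply, Real.norm_eq_abs, sq_abs]
    linarith [hc 0, hc 1, hc 2]
  have h1 : Real.exp (-1) ≤ Real.exp (-R⁻¹ * ‖ξ - q‖ ^ 2) := by
    apply Real.exp_le_exp.2
    have : R⁻¹ * ‖ξ - q‖ ^ 2 ≤ R⁻¹ * R := by gcongr
    rw [inv_mul_cancel₀ hR.ne'] at this
    linarith
  have h2 : Real.exp (-1) * Real.exp 1 = 1 := by rw [← Real.exp_add]; simp
  -- The factor 3 in the statement is an upper bound for `e`.
  nlinarith [Real.exp_one_lt_d9, Real.exp_pos (-1)]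

/-- If on the supports of `F₁`, `F₂` the map `(z₁, z₂) ↦ Φ(z₁) + Φ(z₂)` is injective up to the
scale `r`, with separation `d`, then the product of the extensions has small `L²` norm on cubes
of side length `R^{1/2}`. -/
theorem integral_extension_mul_sq_le {γ R r d : ℝ} (hR : 0 < R) (hr : 0 ≤ r) (hd : 0 ≤ d)
    {F₁ F₂ : ℝ × ℝ → ℂ} (h₁ : MemLp F₁ 2 volume) (h₂ : MemLp F₂ 2 volume)
    (h₁' : Integrable F₁) (h₂' : Integrable F₂)
    (hsep : ∀ w w' : (ℝ × ℝ) × (ℝ × ℝ), F₁ w.1 ≠ 0 → F₂ w.2 ≠ 0 → F₁ w'.1 ≠ 0 → F₂ w'.2 ≠ 0 →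
      dist w w' ≤ 4 ∧ (‖surfacePoint γ w.1 + surfacePoint γ w.2 -
        (surfacePoint γ w'.1 + surfacePoint γ w'.2)‖ ≤ d → dist w w' ≤ r)) (q : E3) :
    IntegrableOn (fun ξ => ‖extension γ F₁ ξ‖ ^ 2 * ‖extension γ F₂ ξ‖ ^ 2) (smallCube R q) ∧
    ∫ ξ in smallCube R q, ‖extension γ F₁ ξ‖ ^ 2 * ‖extension γ F₂ ξ‖ ^ 2 ≤
      3 * (Real.pi * R) ^ (3 / 2 : ℝ) *
        (2 * ((2 * r) ^ 4 + 8 ^ 4 * Real.exp (-(R * d ^ 2 / 4)))) * (sqNorm F₁ * sqNorm F₂) := by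
  set Ψ : (ℝ × ℝ) × (ℝ × ℝ) → E3 := fun w => surfacePoint γ w.1 + surfacePoint γ w.2 with hΨ
  have hΨm : Measurable Ψ := ((measurable_surfacePoint γ).comp measurable_fst).add
    ((measurable_surfacePoint γ).comp measurable_snd)
  set f : (ℝ × ℝ) × (ℝ × ℝ) → ℂ := fun w => F₁ w.1 * F₂ w.2 *
    Complex.exp (Complex.I * (inner ℝ (Ψ w) q : ℝ)) with hf
  have hnorm : ∀ w, ‖f w‖ = ‖F₁ w.1‖ * ‖F₂ w.2‖ := fun w => by
    rw [hf]
    simp only [norm_mul]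
    rw [mul_comm Complex.I, Complex.norm_exp_ofReal_mul_I, mul_one]
  have hfm : AEStronglyMeasurable f (volume.prod volume) := by
    refine (h₁.1.comp_fst.mul h₂.1.comp_snd).mul (Measurable.aestronglyMeasurable ?_)
    have : Measurable fun w => (inner ℝ (Ψ w) q : ℝ) := hΨm.inner measurable_const
    fun_prop
  have hfi : Integrable f (volume.prod volume) := by
    refine (h₁'.mul_prod h₂').mono hfm (Filter.Eventually.of_forall fun w => ?_)
    rw [hnorm, norm_mul]
  have hsq : (fun w => ‖f w‖ ^ 2) = fun w : (ℝ × ℝ) × (ℝ × ℝ) => ‖F₁ w.1‖ ^ 2 * ‖F₂ w.2‖ ^ 2 := by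
    funext w; rw [hnorm, mul_pow]
  have hf2 : MemLp f 2 (volume.prod volume) := by
    rw [memLp_two_iff_integrable_sq_norm hfm, hsq]
    exact (h₁.integrable_norm_pow (by norm_num)).mul_prod (h₂.integrable_norm_pow (by norm_num))
  have hsqn : ∫ w, ‖f w‖ ^ 2 ∂volume.prod volume = sqNorm F₁ * sqNorm F₂ := by
    rw [hsq]
    exact integral_prod_mul (fun z => ‖F₁ z‖ ^ 2) (fun z => ‖F₂ z‖ ^ 2)
  have hb : 0 < R⁻¹ := by positivity
  have hext : ∀ ξ, ‖extension γ F₁ (ξ + q)‖ ^ 2 * ‖extension γ F₂ (ξ + q)‖ ^ 2 =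
      ‖∫ w, f w * Complex.exp (Complex.I * (inner ℝ (Ψ w) ξ : ℝ)) ∂volume.prod volume‖ ^ 2 := by
    intro ξ
    rw [← mul_pow, ← norm_mul, extension_mul_extension]
    rfl
  have hI := integrable_gaussian_mul_sq hfi hΨm hb
  have hB := integral_gaussian_mul_sq_le hfi hΨm hb
  simp_rw [← hext] at hI hB
  have hI' := hI.comp_sub_right q
  have hB' := hB
  rw [← integral_sub_right_eq_self _ q] at hB'
  simp only [sub_add_cancel] at hI' hB'
  have hS : ∫ p : ((ℝ × ℝ) × (ℝ × ℝ)) × ((ℝ × ℝ) × (ℝ × ℝ)), ‖f p.1‖ * ‖f p.2‖ *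
      Real.exp (-‖Ψ p.1 - Ψ p.2‖ ^ 2 / (4 * R⁻¹)) ∂(volume.prod volume) ≤ _ :=
    integral_schur_le hf2 (k := fun p => Real.exp (-‖Ψ p.1 - Ψ p.2‖ ^ 2 / (4 * R⁻¹)))
      (η := Real.exp (-(R * d ^ 2 / 4))) (r := r)
      (by
        have : Measurable fun p : ((ℝ × ℝ) × (ℝ × ℝ)) × ((ℝ × ℝ) × (ℝ × ℝ)) =>
          ‖Ψ p.1 - Ψ p.2‖ := ((hΨm.comp measurable_fst).sub (hΨm.comp measurable_snd)).norm
        fun_prop)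
      (fun _ => Real.exp_nonneg _)
      (fun p => by
        rw [Real.exp_le_one_iff, neg_div]
        exact neg_nonpos.2 (by positivity))
      hr (Real.exp_nonneg _)
      (fun p hp hp' => by
        have hp1 : F₁ p.1.1 ≠ 0 := fun h => hp (by simp [hf, h])
        have hp2 : F₂ p.1.2 ≠ 0 := fun h => hp (by simp [hf, h])
        have hp3 : F₁ p.2.1 ≠ 0 := fun h => hp' (by simp [hf, h])
        have hp4 : F₂ p.2.2 ≠ 0 := fun h => hp' (by simp [hf, h])
        obtain ⟨h4, hs⟩ := hsep p.1 p.2 hp1 hp2 hp3 hp4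
        -- Either the sums of surface points agree up to `d`, and the pairs are close, or the
        -- Gaussian kernel is already as small as the tail bound.
        rcases le_total ‖Ψ p.1 - Ψ p.2‖ d with h | h
        · exact Or.inl (hs h)
        · refine Or.inr ⟨h4, Real.exp_le_exp.2 ?_⟩
          have : d ^ 2 ≤ ‖Ψ p.1 - Ψ p.2‖ ^ 2 := by gcongr
          have h2 : R * d ^ 2 ≤ R * ‖Ψ p.1 - Ψ p.2‖ ^ 2 := by gcongr
          have h3 : -‖Ψ p.1 - Ψ p.2‖ ^ 2 / (4 * R⁻¹) = -(R * ‖Ψ p.1 - Ψ p.2‖ ^ 2 / 4) := by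
            field_simp
          rw [h3]
          linarith)
  have hsqn' : ∫ w, ‖f w‖ ^ 2 = sqNorm F₁ * sqNorm F₂ := hsqn
  rw [hsqn'] at hS
  have hcube : MeasurableSet (smallCube R q) := by
    have : smallCube R q = ⋂ i, {ξ : E3 | |ξ i - q i| ≤ R ^ (1 / 2 : ℝ) / 2} := by
      ext; simp [smallCube]
    rw [this]
    exact MeasurableSet.iInter fun i => (isClosed_le (by fun_prop) (by fun_prop)).measurableSet
  -- Measurability is recovered from the weighted integrand by multiplying with the inverse
  -- Gaussian.
  have hmeas : AEStronglyMeasurable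
      (fun ξ => ‖extension γ F₁ ξ‖ ^ 2 * ‖extension γ F₂ ξ‖ ^ 2) volume := by
    have hc : AEStronglyMeasurable (fun ξ : E3 => Real.exp (R⁻¹ * ‖ξ - q‖ ^ 2)) volume :=
      Continuous.aestronglyMeasurable (by fun_prop)
    refine (hc.mul hI'.1).congr (Filter.Eventually.of_forall fun ξ => ?_)
    simp only [Pi.mul_apply]
    rw [← mul_assoc, ← Real.exp_add]
    simp
  have hle : ∀ ξ ∈ smallCube R q, ‖extension γ F₁ ξ‖ ^ 2 * ‖extension γ F₂ ξ‖ ^ 2 ≤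
      3 * (Real.exp (-R⁻¹ * ‖ξ - q‖ ^ 2) *
        (‖extension γ F₁ ξ‖ ^ 2 * ‖extension γ F₂ ξ‖ ^ 2)) := by
    intro ξ hξ
    rw [← mul_assoc]
    exact le_mul_of_one_le_left (by positivity) (exp_neg_norm_sq_ge_of_mem_smallCube hR hξ)
  have hint : IntegrableOn (fun ξ => ‖extension γ F₁ ξ‖ ^ 2 * ‖extension γ F₂ ξ‖ ^ 2)
      (smallCube R q) := by
    refine (hI'.const_mul 3).restrict.mono hmeas.restrict ?_
    refine (ae_restrict_iff' hcube).2 (Filter.Eventually.of_forall fun ξ hξ => ?_)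
    rw [Real.norm_of_nonneg (by positivity), Real.norm_of_nonneg (by positivity)]
    exact hle ξ hξ
  refine ⟨hint, ?_⟩
  calc _ ≤ ∫ ξ in smallCube R q, 3 * (Real.exp (-R⁻¹ * ‖ξ - q‖ ^ 2) *
        (‖extension γ F₁ ξ‖ ^ 2 * ‖extension γ F₂ ξ‖ ^ 2)) :=
        setIntegral_mono_on hint (hI'.const_mul 3).integrableOn hcube hle
    _ ≤ ∫ ξ, 3 * (Real.exp (-R⁻¹ * ‖ξ - q‖ ^ 2) *
        (‖extension γ F₁ ξ‖ ^ 2 * ‖extension γ F₂ ξ‖ ^ 2)) :=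
        setIntegral_le_integral (hI'.const_mul 3)
          (Filter.Eventually.of_forall fun ξ => by positivity)
    _ ≤ 3 * ((Real.pi / R⁻¹) ^ (3 / 2 : ℝ) * (2 * ((2 * r) ^ 4 +
        8 ^ 4 * Real.exp (-(R * d ^ 2 / 4))) * (sqNorm F₁ * sqNorm F₂))) := by
        rw [integral_const_mul]
        gcongr
        exact hB'.trans (mul_le_mul_of_nonneg_left hS (by positivity))
    _ = _ := by rw [div_inv_eq_mul]; ring

/-! ### Rigidity of four points on a strip -/

theorem abs_mul_le_mul {u v U V : ℝ} (hu : |u| ≤ U) (hv : |v| ≤ V) : |u * v| ≤ U * V := by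
  rw [abs_mul]
  exact mul_le_mul hu hv (abs_nonneg _) ((abs_nonneg _).trans hu)

/-- The normals along a strip that contains two points with separated `y`-coordinates. -/
theorem normal_second_coord_lower_bound {γ κ ρ n₁ n₂ n₃ x₁ y₁ x₂ y₂ : ℝ} (hγ : |γ| ≤ 1)
    (hκ : 0 < κ) (hκ1 : κ ≤ 1) (hρ : ρ ≤ κ / 1000) (hn : n₁ ^ 2 + n₂ ^ 2 + n₃ ^ 2 = 1)
    (hx₁ : |x₁| ≤ 11 / 10) (hy₁ : |y₁| ≤ 11 / 10) (hx₂ : |x₂| ≤ 11 / 10) (hy₂ : |y₂| ≤ 11 / 10)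
    (hy : κ ≤ |y₂ - y₁|)
    (h₁ : |n₁ * y₁ + n₂ * (x₁ + γ * y₁ ^ 2) - n₃| ≤ ρ)
    (h₂ : |n₁ * y₂ + n₂ * (x₂ + γ * y₂ ^ 2) - n₃| ≤ ρ) : κ / 20 ≤ |n₂| := by
  -- If `n₂` were small, subtracting the two strip conditions would make `n₁` small by the
  -- separation in `y`, and then one condition would make `n₃` small, against `‖n‖ = 1`.
  by_contra! hlt
  have hq : ∀ x y : ℝ, |x| ≤ 11 / 10 → |y| ≤ 11 / 10 → |x + γ * y ^ 2| ≤ 231 / 100 := by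
    intro x y hx hy
    have h1 : |γ * y ^ 2| ≤ 1 * (11 / 10 * (11 / 10)) :=
      abs_mul_le_mul hγ (by rw [sq]; exact abs_mul_le_mul hy hy)
    have := abs_add_le x (γ * y ^ 2)
    linarith
  have hq₁ := abs_mul_le_mul hlt.le (hq x₁ y₁ hx₁ hy₁)
  have hq₂ := abs_mul_le_mul hlt.le (hq x₂ y₂ hx₂ hy₂)
  have hn1 : |n₁| * κ ≤ 2333 / 10000 * κ := by
    have e : |n₁ * (y₂ - y₁)| ≤ 2333 / 10000 * κ := by
      rw [abs_le] at *
      constructor <;> linarith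
    rw [abs_mul] at e
    exact (mul_le_mul_of_nonneg_left hy (abs_nonneg _)).trans e
  have hn1' : |n₁| ≤ 2333 / 10000 := le_of_mul_le_mul_right hn1 hκ
  have hn1y := abs_mul_le_mul hn1' hy₁
  have hn3 : |n₃| ≤ 4 / 10 := by
    rw [abs_le] at *
    constructor <;> linarith
  have s1 : n₁ ^ 2 ≤ (2333 / 10000) ^ 2 := sq_le_sq' (abs_le.1 hn1').1 (abs_le.1 hn1').2
  have s3 : n₃ ^ 2 ≤ (4 / 10) ^ 2 := sq_le_sq' (abs_le.1 hn3).1 (abs_le.1 hn3).2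
  have hn2 : |n₂| ≤ 1 / 20 := by linarith
  have s2 : n₂ ^ 2 ≤ (1 / 20) ^ 2 := sq_le_sq' (abs_le.1 hn2).1 (abs_le.1 hn2).2
  norm_num at s1 s2 s3
  linarith

/-- Four points near a curve `x = a y + b - γ y²` for which the sums of the lifts to the graph of
`φ_γ` agree up to `ρ`. -/
theorem curve_rigidity {γ κ ρ M a b x₁ y₁ x₂ y₂ x₁' y₁' x₂' y₂' : ℝ} (hγ : |γ| ≤ 1)
    (hκ : 0 < κ) (hκ1 : κ ≤ 1) (hM : 20 ≤ M) (ha : |a| ≤ M) (hb : |b| ≤ M) (hρ0 : 0 ≤ ρ)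
    (hρ : M * ρ ≤ κ / 100)
    (hy₁ : |y₁| ≤ 11 / 10) (hy₂ : |y₂| ≤ 11 / 10) (hy₁' : |y₁'| ≤ 11 / 10) (hy₂' : |y₂'| ≤ 11 / 10)
    (hy : κ ≤ |y₁' - y₂|)
    (ht : κ ≤ |x₂ - x₁ + γ * y₂ * (y₂ - y₁)| ∨ κ ≤ |x₂ - x₁ + γ * y₁ * (y₂ - y₁)|)
    (h₁ : |x₁ - (a * y₁ + b - γ * y₁ ^ 2)| ≤ M * ρ)
    (h₂ : |x₂ - (a * y₂ + b - γ * y₂ ^ 2)| ≤ M * ρ)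
    (h₁' : |x₁' - (a * y₁' + b - γ * y₁' ^ 2)| ≤ M * ρ)
    (h₂' : |x₂' - (a * y₂' + b - γ * y₂' ^ 2)| ≤ M * ρ)
    (hΔx : |x₁ + x₂ - (x₁' + x₂')| ≤ ρ) (hΔy : |y₁ + y₂ - (y₁' + y₂')| ≤ ρ)
    (hΔφ : |x₁ * y₁ + γ / 3 * y₁ ^ 3 + (x₂ * y₂ + γ / 3 * y₂ ^ 3) -
      (x₁' * y₁' + γ / 3 * y₁' ^ 3 + (x₂' * y₂' + γ / 3 * y₂' ^ 3))| ≤ ρ) :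
    |y₁ - y₁'| ≤ 36 * (M * ρ) / κ ^ 2 ∧ |y₂ - y₂'| ≤ 36 * (M * ρ) / κ ^ 2 ∧
    |x₁ - x₁'| ≤ 50 * M * (M * ρ) / κ ^ 2 ∧ |x₂ - x₂'| ≤ 50 * M * (M * ρ) / κ ^ 2 := by
  obtain ⟨σ, hσ⟩ : ∃ σ, σ = M * ρ := ⟨_, rfl⟩
  simp only [← hσ] at hρ h₁ h₂ h₁' h₂' ⊢
  have hρσ : 20 * ρ ≤ σ := hσ ▸ mul_le_mul_of_nonneg_right hM hρ0
  have hσ0 : 0 ≤ σ := by linarith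
  obtain ⟨e₁, he₁⟩ : ∃ e, e = x₁ - (a * y₁ + b - γ * y₁ ^ 2) := ⟨_, rfl⟩
  obtain ⟨e₂, he₂⟩ : ∃ e, e = x₂ - (a * y₂ + b - γ * y₂ ^ 2) := ⟨_, rfl⟩
  obtain ⟨e₁', he₁'⟩ : ∃ e, e = x₁' - (a * y₁' + b - γ * y₁' ^ 2) := ⟨_, rfl⟩
  obtain ⟨e₂', he₂'⟩ : ∃ e, e = x₂' - (a * y₂' + b - γ * y₂' ^ 2) := ⟨_, rfl⟩
  rw [← he₁] at h₁
  rw [← he₂] at h₂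
  rw [← he₁'] at h₁'
  rw [← he₂'] at h₂'
  obtain rfl : x₁ = a * y₁ + b - γ * y₁ ^ 2 + e₁ := by linarith
  obtain rfl : x₂ = a * y₂ + b - γ * y₂ ^ 2 + e₂ := by linarith
  obtain rfl : x₁' = a * y₁' + b - γ * y₁' ^ 2 + e₁' := by linarith
  obtain rfl : x₂' = a * y₂' + b - γ * y₂' ^ 2 + e₂' := by linarith
  clear he₁ he₂ he₁' he₂'
  obtain ⟨Δ, hΔ⟩ : ∃ Δ, Δ = y₁ + y₂ - (y₁' + y₂') := ⟨_, rfl⟩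
  obtain ⟨D, hD⟩ : ∃ D, D = y₁ ^ 2 + y₂ ^ 2 - (y₁' ^ 2 + y₂' ^ 2) := ⟨_, rfl⟩
  rw [← hΔ] at hΔy
  have haΔ : |a * Δ| ≤ σ := hσ ▸ abs_mul_le_mul ha hΔy
  have hbΔ : |b * Δ| ≤ σ := hσ ▸ abs_mul_le_mul hb hΔy
  -- On the curve, `∑x = a∑y + 2b - γ∑y²` up to `O(σ)`; hence near equality of the sums of `x` and
  -- of `y` controls `γD`.
  have hγD : |γ * D| ≤ 6 * σ := by
    have e : γ * D = a * Δ + (e₁ + e₂ - e₁' - e₂') - (a * y₁ + b - γ * y₁ ^ 2 + e₁ +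
        (a * y₂ + b - γ * y₂ ^ 2 + e₂) - (a * y₁' + b - γ * y₁' ^ 2 + e₁' +
        (a * y₂' + b - γ * y₂' ^ 2 + e₂'))) := by rw [hΔ, hD]; ring
    rw [abs_le] at haΔ hΔx h₁ h₂ h₁' h₂' ⊢
    constructor <;> linarith
  have hs : |y₁ + y₂| ≤ 22 / 10 := (abs_add_le _ _).trans (by linarith)
  have hs' : |y₁' + y₂'| ≤ 22 / 10 := (abs_add_le _ _).trans (by linarith)
  -- For two points, the sum of cubes is a polynomial in the first two power sums. Its difference is
  -- therefore `(3/2)(y₁ + y₂)D` plus a multiple of `Δ`, and the factor `γ` lets the bound for `γD`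
  -- apply.
  have hγS3 : |γ * (y₁ ^ 3 + y₂ ^ 3 - (y₁' ^ 3 + y₂' ^ 3))| ≤ 21 * σ := by
    have e : γ * (y₁ ^ 3 + y₂ ^ 3 - (y₁' ^ 3 + y₂' ^ 3)) = 3 / 2 * ((y₁ + y₂) * (γ * D)) +
        γ * (Δ * (3 / 2 * (y₁' * y₁' + y₂' * y₂') - 1 / 2 * ((y₁ + y₂) * (y₁ + y₂) +
        (y₁ + y₂) * (y₁' + y₂') + (y₁' + y₂') * (y₁' + y₂')))) := by rw [hΔ, hD]; ring
    have b1 := abs_mul_le_mul hs hγD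
    have b2 := abs_mul_le_mul hy₁' hy₁'
    have b3 := abs_mul_le_mul hy₂' hy₂'
    have b4 := abs_mul_le_mul hs hs
    have b5 := abs_mul_le_mul hs hs'
    have b6 := abs_mul_le_mul hs' hs'
    have b7 : |3 / 2 * (y₁' * y₁' + y₂' * y₂') - 1 / 2 * ((y₁ + y₂) * (y₁ + y₂) +
        (y₁ + y₂) * (y₁' + y₂') + (y₁' + y₂') * (y₁' + y₂'))| ≤ 11 := by
      rw [abs_le] at b2 b3 b4 b5 b6 ⊢
      constructor <;> linarith
    have b8 := abs_mul_le_mul hγ (abs_mul_le_mul hΔy b7)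
    rw [e]
    rw [abs_le] at b1 b8 ⊢
    constructor <;> linarith
  -- The phase on the curve is `ay² + by - (2/3)γy³` up to `O(σ)`; the cubic and linear terms are
  -- already controlled, leaving `aD`.
  have haD : |a * D| ≤ 21 * σ := by
    have c₁ := abs_mul_le_mul h₁ hy₁
    have c₂ := abs_mul_le_mul h₂ hy₂
    have c₁' := abs_mul_le_mul h₁' hy₁'
    have c₂' := abs_mul_le_mul h₂' hy₂'
    have e : a * D = 2 / 3 * (γ * (y₁ ^ 3 + y₂ ^ 3 - (y₁' ^ 3 + y₂' ^ 3))) - b * Δ -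
        (e₁ * y₁ + e₂ * y₂ - e₁' * y₁' - e₂' * y₂') +
        ((a * y₁ + b - γ * y₁ ^ 2 + e₁) * y₁ + γ / 3 * y₁ ^ 3 +
          ((a * y₂ + b - γ * y₂ ^ 2 + e₂) * y₂ + γ / 3 * y₂ ^ 3) -
        ((a * y₁' + b - γ * y₁' ^ 2 + e₁') * y₁' + γ / 3 * y₁' ^ 3 +
          ((a * y₂' + b - γ * y₂' ^ 2 + e₂') * y₂' + γ / 3 * y₂' ^ 3))) := by rw [hΔ, hD]; ring
    rw [abs_le] at c₁ c₂ c₁' c₂' hΔφ hbΔ hγS3 ⊢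
    constructor <;> linarith
  -- On the curve, each of the two transversality quantities is `(y₂ - y₁)(a - γy)` up to `2σ`, with
  -- `y` one of `y₁`, `y₂`. Hence `a` and `γ` cannot both be small.
  have hlow : 4 / 10 * κ ≤ |a| + |γ| := by
    have key : ∀ y t : ℝ, |y| ≤ 11 / 10 → t = (y₂ - y₁) * (a - γ * y) + (e₂ - e₁) → κ ≤ |t| →
        4 / 10 * κ ≤ |a| + |γ| := by
      intro y t hy ht hκt
      have d1 : |a - γ * y| ≤ |a| + |γ| * (11 / 10) := by
        refine (abs_sub _ _).trans ?_
        gcongr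
        exact abs_mul_le_mul le_rfl hy
      have d2 : |y₂ - y₁| ≤ 22 / 10 := (abs_sub _ _).trans (by linarith)
      have d3 := abs_mul_le_mul d2 d1
      have d4 : |e₂ - e₁| ≤ 2 * σ := by rw [abs_le] at h₁ h₂ ⊢; constructor <;> linarith
      have d5 := abs_add_le ((y₂ - y₁) * (a - γ * y)) (e₂ - e₁)
      rw [← ht] at d5
      linarith [abs_nonneg a, abs_nonneg γ]
    rcases ht with ht | ht
    · exact key y₁ _ hy₁ (by ring) ht
    · exact key y₂ _ hy₂ (by ring) ht
  have hDle : |D| * κ ≤ 68 * σ := by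
    have : (|a| + |γ|) * |D| ≤ 27 * σ := by
      rw [add_mul, ← abs_mul, ← abs_mul]; linarith
    have h2 := mul_le_mul_of_nonneg_right hlow (abs_nonneg D)
    linarith
  -- Up to multiples of `Δ`, the product `(y₁' - y₁)(y₁' - y₂)` equals `-D/2`. Its second factor is
  -- at least `κ` in absolute value, which rules out exchanging the two points.
  have hprod : |y₁' - y₁| * |y₁' - y₂| * κ ≤ 35 * σ := by
    have e : (y₁' - y₁) * (y₁' - y₂) =
        -(Δ * y₁') + (Δ * (y₁ + y₂) + Δ * (y₁' + y₂') - D) / 2 := by rw [hΔ, hD]; ring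
    have f1 := abs_mul_le_mul hΔy hy₁'
    have f2 := abs_mul_le_mul hΔy hs
    have f3 := abs_mul_le_mul hΔy hs'
    have f4 : |(y₁' - y₁) * (y₁' - y₂)| ≤ 33 / 10 * ρ + |D| / 2 := by
      rw [e]
      have := neg_abs_le D
      have := le_abs_self D
      rw [abs_le] at f1 f2 f3 ⊢
      constructor <;> linarith
    rw [← abs_mul]
    calc _ ≤ (33 / 10 * ρ + |D| / 2) * κ := by gcongr
      _ = 33 / 10 * (ρ * κ) + (|D| * κ) / 2 := by ring
      _ ≤ 33 / 10 * (ρ * 1) + (68 * σ) / 2 := by gcongr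
      _ ≤ _ := by linarith
  have hκ2 : 0 < κ ^ 2 := by positivity
  have hκ2' : κ ^ 2 ≤ 1 := pow_le_one₀ hκ.le hκ1
  have g1 : |y₁ - y₁'| * κ ^ 2 ≤ 35 * σ := by
    rw [abs_sub_comm]
    calc |y₁' - y₁| * κ ^ 2 = |y₁' - y₁| * κ * κ := by ring
      _ ≤ |y₁' - y₁| * |y₁' - y₂| * κ := by gcongr
      _ ≤ _ := hprod
  have g2 : |y₂ - y₂'| * κ ^ 2 ≤ 36 * σ := by
    have : |y₂ - y₂'| ≤ ρ + |y₁ - y₁'| := by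
      have e : y₂ - y₂' = Δ - (y₁ - y₁') := by rw [hΔ]; ring
      rw [e]
      exact (abs_sub _ _).trans (by gcongr)
    calc _ ≤ (ρ + |y₁ - y₁'|) * κ ^ 2 := by gcongr
      _ = ρ * κ ^ 2 + |y₁ - y₁'| * κ ^ 2 := by ring
      _ ≤ ρ * 1 + 35 * σ := by gcongr
      _ ≤ _ := by linarith
  have gx : ∀ y y' e e' : ℝ, |y| ≤ 11 / 10 → |y'| ≤ 11 / 10 → |e| ≤ σ → |e'| ≤ σ →
      |y - y'| * κ ^ 2 ≤ 36 * σ →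
      |(a * y + b - γ * y ^ 2 + e) - (a * y' + b - γ * y' ^ 2 + e')| ≤ 50 * M * σ / κ ^ 2 := by
    intro y y' e e' hy hy' he he' h
    rw [le_div_iff₀ hκ2]
    have i1 : |y + y'| ≤ 22 / 10 := (abs_add_le _ _).trans (by linarith)
    have i2 : |a - γ * (y + y')| ≤ M + 1 * (22 / 10) :=
      (abs_sub _ _).trans (add_le_add ha (abs_mul_le_mul hγ i1))
    have i3 : |(a * y + b - γ * y ^ 2 + e) - (a * y' + b - γ * y' ^ 2 + e')| ≤
        (M + 1 * (22 / 10)) * |y - y'| + 2 * σ := by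
      have e0 : (a * y + b - γ * y ^ 2 + e) - (a * y' + b - γ * y' ^ 2 + e') =
        (a - γ * (y + y')) * (y - y') + (e - e') := by ring
      rw [e0]
      refine (abs_add_le _ _).trans (add_le_add (abs_mul_le_mul i2 le_rfl) ?_)
      exact (abs_sub _ _).trans (by linarith)
    calc _ ≤ ((M + 1 * (22 / 10)) * |y - y'| + 2 * σ) * κ ^ 2 := by gcongr
      _ = (M + 1 * (22 / 10)) * (|y - y'| * κ ^ 2) + 2 * σ * κ ^ 2 := by ring
      _ ≤ (M + 1 * (22 / 10)) * (36 * σ) + 2 * σ * 1 := by gcongr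
      _ ≤ _ := by linarith [mul_le_mul_of_nonneg_right hM hσ0]
  refine ⟨?_, ?_, gx _ _ _ _ hy₁ hy₁' h₁ h₁' (by linarith), gx _ _ _ _ hy₂ hy₂' h₂ h₂' g2⟩
  · rw [le_div_iff₀ hκ2]; linarith
  · rw [le_div_iff₀ hκ2]; exact g2

/-- Two pairs of points on a strip `{n · N = O(ρ)}`, transversal within the pair, for which the sums
of the lifts to the graph of `φ_γ` agree up to `ρ`. -/
theorem strip_rigidity {γ κ ρ n₁ n₂ n₃ : ℝ} {z₁ z₂ z₁' z₂' : ℝ × ℝ} (hγ : |γ| ≤ 1)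
    (hκ : 0 < κ) (hκ1 : κ ≤ 1) (hρ0 : 0 ≤ ρ) (hρ : ρ ≤ κ ^ 2 / 2000)
    (hn : n₁ ^ 2 + n₂ ^ 2 + n₃ ^ 2 = 1)
    (hz₁ : |z₁.1| ≤ 11 / 10 ∧ |z₁.2| ≤ 11 / 10) (hz₂ : |z₂.1| ≤ 11 / 10 ∧ |z₂.2| ≤ 11 / 10)
    (hz₁' : |z₁'.1| ≤ 11 / 10 ∧ |z₁'.2| ≤ 11 / 10) (hz₂' : |z₂'.1| ≤ 11 / 10 ∧ |z₂'.2| ≤ 11 / 10)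
    (hy : κ ≤ |z₂.2 - z₁.2|) (hy' : κ ≤ |z₁'.2 - z₂.2|)
    (ht : κ ≤ max |transversality γ z₁ z₁ z₂| |transversality γ z₂ z₁ z₂|)
    (h₁ : |n₁ * z₁.2 + n₂ * (z₁.1 + γ * z₁.2 ^ 2) - n₃| ≤ ρ)
    (h₂ : |n₁ * z₂.2 + n₂ * (z₂.1 + γ * z₂.2 ^ 2) - n₃| ≤ ρ)
    (h₁' : |n₁ * z₁'.2 + n₂ * (z₁'.1 + γ * z₁'.2 ^ 2) - n₃| ≤ ρ)
    (h₂' : |n₁ * z₂'.2 + n₂ * (z₂'.1 + γ * z₂'.2 ^ 2) - n₃| ≤ ρ)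
    (hΔx : |z₁.1 + z₂.1 - (z₁'.1 + z₂'.1)| ≤ ρ) (hΔy : |z₁.2 + z₂.2 - (z₁'.2 + z₂'.2)| ≤ ρ)
    (hΔφ : |phase γ z₁ + phase γ z₂ - (phase γ z₁' + phase γ z₂')| ≤ ρ) :
    dist (z₁, z₂) (z₁', z₂') ≤ 20000 * ρ / κ ^ 4 := by
  have hκ2 : κ ^ 2 ≤ κ := by nlinarith
  have hn2 := normal_second_coord_lower_bound hγ hκ hκ1 (by linarith) hn hz₁.1 hz₁.2 hz₂.1 hz₂.2
    hy h₁ h₂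
  have hn20 : 0 < |n₂| := by have : 0 < κ / 20 := by positivity
                             linarith
  have hn2' : n₂ ≠ 0 := abs_pos.1 hn20
  have hinv : |n₂|⁻¹ ≤ 20 / κ := by
    rw [inv_le_comm₀ hn20 (by positivity), inv_div]; exact hn2
  have hle1 : ∀ t : ℝ, t ^ 2 ≤ 1 → |t| ≤ 1 := fun t h => by
    rwa [← sq_le_one_iff_abs_le_one]
  have hM : (20 : ℝ) ≤ 20 / κ := by rw [le_div_iff₀ hκ]; linarith
  have hcoef : ∀ t : ℝ, |t| ≤ 1 → |t / n₂| ≤ 20 / κ := fun t h => by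
    rw [abs_div, div_eq_mul_inv]
    calc _ ≤ 1 * (20 / κ) := by gcongr
      _ = _ := one_mul _
  have ha := hcoef (-n₁) (by rw [abs_neg]; exact hle1 _ (by nlinarith))
  have hb := hcoef n₃ (hle1 _ (by nlinarith))
  have hcurve : ∀ z : ℝ × ℝ, |n₁ * z.2 + n₂ * (z.1 + γ * z.2 ^ 2) - n₃| ≤ ρ →
      |z.1 - (-n₁ / n₂ * z.2 + n₃ / n₂ - γ * z.2 ^ 2)| ≤ 20 / κ * ρ := by
    intro z h
    have e : z.1 - (-n₁ / n₂ * z.2 + n₃ / n₂ - γ * z.2 ^ 2) =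
        n₂⁻¹ * (n₁ * z.2 + n₂ * (z.1 + γ * z.2 ^ 2) - n₃) := by field_simp; ring
    rw [e]
    exact abs_mul_le_mul (by rwa [abs_inv]) h
  have hMρ : 20 / κ * ρ ≤ κ / 100 := by
    rw [div_mul_eq_mul_div, div_le_iff₀ hκ]; nlinarith
  have ht' : κ ≤ |z₂.1 - z₁.1 + γ * z₂.2 * (z₂.2 - z₁.2)| ∨
      κ ≤ |z₂.1 - z₁.1 + γ * z₁.2 * (z₂.2 - z₁.2)| := by
    rcases le_max_iff.1 ht with h | h
    · left; simpa [transversality] using h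
    · right; simpa [transversality] using h
  obtain ⟨r1, r2, r3, r4⟩ := curve_rigidity hγ hκ hκ1 hM ha hb hρ0 hMρ hz₁.2 hz₂.2 hz₁'.2 hz₂'.2
    hy' ht' (hcurve z₁ h₁) (hcurve z₂ h₂) (hcurve z₁' h₁') (hcurve z₂' h₂') hΔx hΔy hΔφ
  -- With `M = 20/κ`, the bound `50 M (Mρ) / κ²` becomes `20000 ρ / κ⁴`.
  have E1 : 50 * (20 / κ) * (20 / κ * ρ) / κ ^ 2 = 20000 * ρ / κ ^ 4 := by field_simp; ring
  have E2 : 36 * (20 / κ * ρ) / κ ^ 2 ≤ 20000 * ρ / κ ^ 4 := by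
    rw [← E1]
    gcongr
    linarith
  rw [E1] at r3 r4
  simp only [Prod.dist_eq, Real.dist_eq, max_le_iff]
  exact ⟨⟨r3, r1.trans E2⟩, ⟨r4, r2.trans E2⟩⟩

/-! ### Packing and counting of tubes -/

/-- A finite `r`-separated set in a ball of radius `m r`. -/
theorem card_le_of_separated {s : Finset E3} {p : E3} {r m : ℝ} (hr : 0 < r) (hm : 0 ≤ m)
    (hsep : ∀ a ∈ s, ∀ b ∈ s, a ≠ b → r ≤ dist a b) (hball : ∀ a ∈ s, dist a p ≤ m * r) :
    (s.card : ℝ) ≤ (4 * m + 3) ^ 3 := by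
  classical
  -- Cells of side `r/2` have diagonal `(√3/2) r < r`, so each contains at most one point of the
  -- set.
  set F : E3 → Fin 3 → ℤ := fun a i => ⌊2 * (a i - p i) / r⌋ with hF
  have hcoord : ∀ (a b : E3) (i : Fin 3), |a i - b i| ≤ dist a b := fun a b i => by
    rw [dist_eq_norm]
    simpa using PiLp.norm_apply_le (a - b) i
  have hmaps : ∀ a ∈ s, F a ∈ Fintype.piFinset fun _ : Fin 3 => Finset.Icc ⌊-(2 * m)⌋ ⌊2 * m⌋ := by
    intro a ha
    rw [Fintype.mem_piFinset]
    intro i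
    have h := abs_le.1 ((hcoord a p i).trans (hball a ha))
    rw [Finset.mem_Icc]
    constructor
    · apply Int.floor_le_floor
      rw [le_div_iff₀ hr]; linarith [h.1]
    · apply Int.floor_le_floor
      rw [div_le_iff₀ hr]; linarith [h.2]
  have hinj : Set.InjOn F s := by
    intro a ha b hb hab
    by_contra hne
    have h1 : ∀ i, (a i - b i) ^ 2 ≤ r ^ 2 / 4 := by
      intro i
      have h2 := Int.abs_sub_lt_one_of_floor_eq_floor (congrFun hab i)
      rw [← sub_div, abs_div, abs_of_pos hr, div_lt_one hr] at h2
      have h3 : |2 * (a i - b i)| ≤ r := by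
        have e : 2 * (a i - b i) = 2 * (a i - p i) - 2 * (b i - p i) := by ring
        rw [e]; exact h2.le
      have := sq_le_sq' (abs_le.1 h3).1 (abs_le.1 h3).2
      linarith
    have h4 := hsep a ha b hb hne
    have h5 : dist a b ^ 2 < r ^ 2 := by
      rw [EuclideanSpace.dist_eq, Real.sq_sqrt (by positivity), Fin.sum_univ_three]
      simp only [Real.dist_eq, sq_abs]
      have : 0 < r ^ 2 := by positivity
      linarith [h1 0, h1 1, h1 2]
    exact absurd h5 (not_lt.2 (pow_le_pow_left₀ hr.le h4 2))
  have hcard := Finset.card_le_card_of_injOn F hmaps hinj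
  rw [Fintype.card_piFinset] at hcard
  simp only [Finset.prod_const, Finset.card_univ, Fintype.card_fin, Int.card_Icc] at hcard
  have hfl : ((⌊2 * m⌋ + 1 - ⌊-(2 * m)⌋).toNat : ℝ) ≤ 4 * m + 3 := by
    have h0 : 0 ≤ ⌊2 * m⌋ + 1 - ⌊-(2 * m)⌋ := by
      have := Int.floor_le_floor (show -(2 * m) ≤ 2 * m by linarith)
      linarith
    have : ((⌊2 * m⌋ + 1 - ⌊-(2 * m)⌋).toNat : ℝ) = ((⌊2 * m⌋ + 1 - ⌊-(2 * m)⌋ : ℤ) : ℝ) := by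
      exact_mod_cast congrArg (Int.cast : ℤ → ℝ) (Int.toNat_of_nonneg h0)
    rw [this]
    push_cast
    linarith [Int.floor_le (2 * m), Int.sub_one_lt_floor (-(2 * m))]
  calc (s.card : ℝ) ≤ ((⌊2 * m⌋ + 1 - ⌊-(2 * m)⌋).toNat : ℝ) ^ 3 := by exact_mod_cast hcard
    _ ≤ _ := by gcongr

theorem norm_sub_inner_smul_le {ν : E3} (hν : ‖ν‖ = 1) (v : E3) :
    ‖v - (inner ℝ ν v : ℝ) • ν‖ ≤ ‖v‖ := by
  refine le_of_sq_le_sq ?_ (norm_nonneg _)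
  rw [norm_sub_sq_real, norm_smul, real_inner_smul_right, hν, mul_one, Real.norm_eq_abs, sq_abs,
    real_inner_comm]
  nlinarith [sq_nonneg (inner ℝ ν v : ℝ)]

theorem one_le_norm_normal (γ : ℝ) (z : ℝ × ℝ) : 1 ≤ ‖normal γ z‖ := by
  have := PiLp.norm_apply_le (normal γ z) 2
  simpa [normal] using this

theorem norm_gridNormal (γ R : ℝ) (θ : GridIndex R) : ‖gridNormal γ R θ‖ = 1 := by
  have := one_le_norm_normal γ (gridCenter R θ)
  rw [gridNormal, unitNormal, norm_smul, norm_inv, norm_norm, inv_mul_cancel₀ (by linarith)]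

section Tubes

variable {γ R δ : ℝ}

/-- The number of parallel tubes that meet a given ball. -/
theorem card_centers_meeting_le (hR : 0 < R) (𝕋 : TubeFamily γ R) (θ : GridIndex R)
    {S : Set E3} {p : E3} {D m : ℝ} (hS : ∀ ξ ∈ S, dist ξ p ≤ D)
    {s : Finset E3} (hs : s ⊆ 𝕋.centers θ)
    (hmeet : ∀ a ∈ s, (tube γ δ (⟨θ, a⟩ : TubeIndex R) ∩ S).Nonempty) (hm : 0 ≤ m)
    (hD : R ^ (1 / 2 + δ : ℝ) + D ≤ m * R ^ (1 / 2 : ℝ)) : (s.card : ℝ) ≤ (4 * m + 3) ^ 3 := by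
  set ν := gridNormal γ R θ with hν
  have hν1 : ‖ν‖ = 1 := norm_gridNormal γ R θ
  -- Projection along `ν` fixes the centers and does not increase distances. Every center is thus
  -- within the tube radius plus `D` of the projection of `p`.
  refine card_le_of_separated (p := p - (inner ℝ ν p : ℝ) • ν) (Real.rpow_pos_of_pos hR _) hm
    (fun a ha b hb => 𝕋.separated θ a (hs ha) b (hs hb)) fun a ha => ?_
  obtain ⟨ξ, hξT, hξS⟩ := hmeet a ha
  have h1 : ‖ξ - a - (inner ℝ ν (ξ - a) : ℝ) • ν‖ ≤ 1 * R ^ (1 / 2 + δ : ℝ) := hξT.1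
  have h2 : ‖(ξ - p) - (inner ℝ ν (ξ - p) : ℝ) • ν‖ ≤ D :=
    (norm_sub_inner_smul_le hν1 _).trans (by rw [← dist_eq_norm]; exact hS ξ hξS)
  have h3 : (inner ℝ ν a : ℝ) = 0 := 𝕋.orthogonal θ a (hs ha)
  rw [inner_sub_right] at h1 h2
  rw [h3, sub_zero] at h1
  rw [dist_eq_norm]
  have e : a - (p - (inner ℝ ν p : ℝ) • ν) = ((ξ - p) - ((inner ℝ ν ξ - inner ℝ ν p : ℝ)) • ν) -
      (ξ - a - (inner ℝ ν ξ : ℝ) • ν) := by rw [sub_smul]; abel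
  rw [e]
  refine (norm_sub_le _ _).trans ?_
  linarith

theorem dist_le_of_abs_sub_le {ξ p : E3} {t : ℝ} (ht : 0 ≤ t) (h : ∀ i, |ξ i - p i| ≤ t) :
    dist ξ p ≤ 2 * t := by
  rw [EuclideanSpace.dist_eq, Fin.sum_univ_three]
  refine Real.sqrt_le_iff.2 ⟨by positivity, ?_⟩
  have hi : ∀ i, dist (ξ i) (p i) ^ 2 ≤ t ^ 2 := fun i => by
    rw [Real.dist_eq]; exact pow_le_pow_left₀ (abs_nonneg _) (h i) 2
  nlinarith [hi 0, hi 1, hi 2, sq_nonneg t]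

theorem dist_center_le_of_mem_smallCube (hR : 0 < R) {q ξ : E3} (h : ξ ∈ smallCube R q) :
    dist ξ q ≤ R ^ (1 / 2 : ℝ) := by
  have := dist_le_of_abs_sub_le (t := R ^ (1 / 2 : ℝ) / 2) (by positivity) h
  linarith

theorem rpow_half_le_rpow_half_add (hR : 1 ≤ R) (hδ : 0 ≤ δ) :
    R ^ (1 / 2 : ℝ) ≤ R ^ (1 / 2 + δ : ℝ) := Real.rpow_le_rpow_of_exponent_le hR (by linarith)

/-- The number of parallel tubes that meet a small cube. -/
theorem card_centers_meeting_smallCube_le (hR : 1 ≤ R) (hδ : 0 ≤ δ) (𝕋 : TubeFamily γ R)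
    (θ : GridIndex R) {q : E3} {s : Finset E3} (hs : s ⊆ 𝕋.centers θ)
    (hmeet : ∀ a ∈ s, (tube γ δ (⟨θ, a⟩ : TubeIndex R) ∩ smallCube R q).Nonempty) :
    (s.card : ℝ) ≤ (11 * R ^ δ) ^ 3 := by
  have hR0 : 0 < R := by linarith
  have h1 : (1 : ℝ) ≤ R ^ δ := Real.one_le_rpow hR hδ
  refine (card_centers_meeting_le hR0 𝕋 θ (m := 2 * R ^ δ)
    (fun ξ hξ => dist_center_le_of_mem_smallCube hR0 hξ) hs hmeet (by positivity) ?_).trans ?_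
  · have := rpow_half_le_rpow_half_add hR hδ
    have e : R ^ (1 / 2 + δ : ℝ) = R ^ δ * R ^ (1 / 2 : ℝ) := by
      rw [← Real.rpow_add hR0, add_comm]
    linarith
  · gcongr
    linarith

/-- The number of parallel tubes that meet `B_j`. -/
theorem card_centers_meeting_smallBall_le (hR : 1 ≤ R) (hδ : 0 ≤ δ) (hδ' : δ ≤ 1 / 4)
    (𝕋 : TubeFamily γ R) (θ : GridIndex R) {b : E3} {s : Finset E3} (hs : s ⊆ 𝕋.centers θ)
    (hmeet : ∀ a ∈ s, (tube γ δ (⟨θ, a⟩ : TubeIndex R) ∩ smallBall R δ b).Nonempty) :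
    (s.card : ℝ) ≤ (11 * R ^ (1 / 2 : ℝ)) ^ 3 := by
  have hR0 : 0 < R := by linarith
  have h1 : (1 : ℝ) ≤ R ^ (1 / 2 : ℝ) := Real.one_le_rpow hR (by norm_num)
  refine (card_centers_meeting_le hR0 𝕋 θ (m := 2 * R ^ (1 / 2 : ℝ)) (D := R ^ (1 - δ : ℝ))
    (fun ξ hξ => by simpa [smallBall, dilatedBall] using hξ) hs hmeet (by positivity) ?_).trans ?_
  · have e : R ^ (1 / 2 : ℝ) * R ^ (1 / 2 : ℝ) = R := by
      rw [← Real.rpow_add hR0]; norm_num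
    have h2 : R ^ (1 / 2 + δ : ℝ) ≤ R ^ (1 : ℝ) := Real.rpow_le_rpow_of_exponent_le hR (by linarith)
    have h3 : R ^ (1 - δ : ℝ) ≤ R ^ (1 : ℝ) := Real.rpow_le_rpow_of_exponent_le hR (by linarith)
    rw [Real.rpow_one] at h2 h3
    linarith
  · gcongr
    linarith

theorem card_gridIndex_le (hR : 1 ≤ R) : (Fintype.card (GridIndex R) : ℝ) ≤ 4 * R := by
  have hR0 : 0 < R := by linarith
  have h1 : (1 : ℝ) ≤ R ^ (1 / 2 : ℝ) := Real.one_le_rpow hR (by norm_num)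
  have e : R ^ (1 / 2 : ℝ) * R ^ (1 / 2 : ℝ) = R := by
    rw [← Real.rpow_add hR0]; norm_num
  have h2 : (⌈R ^ (1 / 2 : ℝ)⌉₊ : ℝ) ≤ 2 * R ^ (1 / 2 : ℝ) :=
    (Nat.ceil_lt_add_one (by positivity)).le.trans (by linarith)
  simp only [Fintype.card_prod, Fintype.card_fin]
  push_cast
  calc _ ≤ (2 * R ^ (1 / 2 : ℝ)) * (2 * R ^ (1 / 2 : ℝ)) := by gcongr
    _ = 4 * (R ^ (1 / 2 : ℝ) * R ^ (1 / 2 : ℝ)) := by ring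
    _ = _ := by rw [e]

theorem card_sigma_le {s : Finset (TubeIndex R)} {t : Finset (GridIndex R)} {N : ℝ}
    (hst : ∀ T ∈ s, T.1 ∈ t)
    (hN : ∀ θ ∈ t, ∀ u : Finset E3, (∀ a ∈ u, (⟨θ, a⟩ : TubeIndex R) ∈ s) → (u.card : ℝ) ≤ N) :
    (s.card : ℝ) ≤ t.card * N := by
  classical
  set f : GridIndex R → Finset E3 := fun θ => s.preimage (fun a => (⟨θ, a⟩ : TubeIndex R))
    (fun a _ b _ h => by simpa using h)
  have hsub : s ⊆ t.sigma f := fun T hT => by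
    rw [Finset.mem_sigma]
    exact ⟨hst T hT, Finset.mem_preimage.2 hT⟩
  calc (s.card : ℝ) ≤ ((t.sigma f).card : ℝ) := by exact_mod_cast Finset.card_le_card hsub
    _ = ∑ θ ∈ t, ((f θ).card : ℝ) := by rw [Finset.card_sigma]; push_cast; rfl
    _ ≤ ∑ θ ∈ t, N := Finset.sum_le_sum fun θ hθ => hN θ hθ _ fun a ha => Finset.mem_preimage.1 ha
    _ = _ := by simp

theorem mem_tangTubes {𝕋 : TubeFamily γ R} {P : MvPolynomial (Fin 3) ℝ} {b : E3}
    {T : TubeIndex R} : T ∈ tangTubes δ 𝕋 P b ↔ T.2 ∈ 𝕋.centers T.1 ∧ IsTangential γ δ P b T := by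
  simp [tangTubes, TubeFamily.tubes]

theorem card_tangTubes_le (hR : 1 ≤ R) (hδ : 0 ≤ δ) (hδ' : δ ≤ 1 / 4) (𝕋 : TubeFamily γ R)
    (P : MvPolynomial (Fin 3) ℝ) (b : E3) :
    ((tangTubes δ 𝕋 P b).card : ℝ) ≤ 4 * R * (11 * R ^ (1 / 2 : ℝ)) ^ 3 := by
  refine (card_sigma_le (t := Finset.univ) (N := (11 * R ^ (1 / 2 : ℝ)) ^ 3)
    (fun _ _ => Finset.mem_univ _) fun θ _ u hu => ?_).trans ?_
  · refine card_centers_meeting_smallBall_le hR hδ hδ' 𝕋 θ (b := b)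
      (fun a ha => (mem_tangTubes.1 (hu a ha)).1) fun a ha => ?_
    obtain ⟨ξ, hξ⟩ := (mem_tangTubes.1 (hu a ha)).2.1
    exact ⟨ξ, hξ.1.1, hξ.2⟩
  · have := card_gridIndex_le hR
    rw [Finset.card_univ]
    gcongr

/-- A closed interval of length 3 contains at most four integers. Per coordinate this counts the
squares `3θ` through a point, measured in units of the grid. -/
theorem card_nat_near_le (n : ℕ) (u : ℝ) (s : Finset (Fin n))
    (hs : ∀ i ∈ s, |((i : ℕ) : ℝ) - u| ≤ 3 / 2) : s.card ≤ 4 := by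
  have hinj : Set.InjOn (fun i : Fin n => ((i : ℕ) : ℤ)) s := fun i _ j _ h => by
    apply Fin.ext; simpa using h
  have hmaps : ∀ i ∈ s, ((i : ℕ) : ℤ) ∈ Finset.Icc ⌈u - 3 / 2⌉ (⌈u - 3 / 2⌉ + 3) := fun i hi => by
    have h := abs_le.1 (hs i hi)
    rw [Finset.mem_Icc]
    constructor
    · rw [Int.ceil_le]; push_cast; linarith [h.1]
    · have h2 : ((i : ℕ) : ℝ) ≤ ⌈u - 3 / 2⌉ + 3 := by linarith [h.2, Int.le_ceil (u - 3 / 2)]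
      exact_mod_cast h2
  have := Finset.card_le_card_of_injOn _ hmaps hinj
  rw [Int.card_Icc] at this
  refine this.trans (le_of_eq ?_)
  omega

/-- Bounded overlap of the squares `3θ`. -/
theorem card_tripleSquare_le (hR : 0 < R) (z : ℝ × ℝ) (t : Finset (GridIndex R))
    (ht : ∀ θ ∈ t, z ∈ tripleSquare R θ) : (t.card : ℝ) ≤ 16 := by
  classical
  have hp : 0 < R ^ (-(1 / 2) : ℝ) := Real.rpow_pos_of_pos hR _
  have hcoord : ∀ (n : ℕ) (w : ℝ), |w - ((n : ℝ) + 1 / 2) * R ^ (-(1 / 2) : ℝ)| ≤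
      3 * R ^ (-(1 / 2) : ℝ) / 2 → |(n : ℝ) - (w / R ^ (-(1 / 2) : ℝ) - 1 / 2)| ≤ 3 / 2 := by
    intro n w h
    have e : w - ((n : ℝ) + 1 / 2) * R ^ (-(1 / 2) : ℝ) =
        -((n : ℝ) - (w / R ^ (-(1 / 2) : ℝ) - 1 / 2)) * R ^ (-(1 / 2) : ℝ) := by
      field_simp; ring
    rw [e, abs_mul, abs_neg, abs_of_pos hp] at h
    refine le_of_mul_le_mul_right (h.trans (le_of_eq (by ring))) hp
  have hsub : t ⊆ t.image Prod.fst ×ˢ t.image Prod.snd := fun θ hθ => by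
    rw [Finset.mem_product]
    exact ⟨Finset.mem_image_of_mem _ hθ, Finset.mem_image_of_mem _ hθ⟩
  have h1 : (t.image Prod.fst).card ≤ 4 :=
    card_nat_near_le _ (z.1 / R ^ (-(1 / 2) : ℝ) - 1 / 2) _ fun i hi => by
      obtain ⟨θ, hθ, rfl⟩ := Finset.mem_image.1 hi
      exact hcoord _ _ (ht θ hθ).1
  have h2 : (t.image Prod.snd).card ≤ 4 :=
    card_nat_near_le _ (z.2 / R ^ (-(1 / 2) : ℝ) - 1 / 2) _ fun i hi => by
      obtain ⟨θ, hθ, rfl⟩ := Finset.mem_image.1 hi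
      exact hcoord _ _ (ht θ hθ).2
  have h3 := Finset.card_le_card hsub
  rw [Finset.card_product] at h3
  have : t.card ≤ 4 * 4 := h3.trans (Nat.mul_le_mul h1 h2)
  exact_mod_cast this

/-- The number of tubes through a small cube whose squares `3θ` contain a given point. -/
theorem card_overlap_le (hR : 1 ≤ R) (hδ : 0 ≤ δ) (𝕋 : TubeFamily γ R) {q : E3} (z : ℝ × ℝ)
    {s : Finset (TubeIndex R)} (hs : ∀ T ∈ s, T.2 ∈ 𝕋.centers T.1)
    (hmeet : ∀ T ∈ s, (tube γ δ T ∩ smallCube R q).Nonempty)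
    (hz : ∀ T ∈ s, z ∈ tripleSquare R T.1) : (s.card : ℝ) ≤ 16 * (11 * R ^ δ) ^ 3 := by
  classical
  refine (card_sigma_le (t := s.image Sigma.fst) (N := (11 * R ^ δ) ^ 3)
    (fun T hT => Finset.mem_image_of_mem _ hT) fun θ _ u hu => ?_).trans ?_
  · exact card_centers_meeting_smallCube_le hR hδ 𝕋 θ (fun a ha => hs _ (hu a ha))
      fun a ha => hmeet _ (hu a ha)
  · gcongr
    refine card_tripleSquare_le (by linarith) z _ fun θ hθ => ?_
    obtain ⟨T, hT, rfl⟩ := Finset.mem_image.1 hθ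
    exact hz T hT

/-! ### Tangential tubes through a small cube -/

/-- The directions of the tangential tubes that meet a cube near the wall are nearly orthogonal to
a fixed unit vector. -/
theorem exists_common_normal (hR : 1 ≤ R) (hδ : 0 ≤ δ) (hδ' : δ ≤ 1 / 4)
    {P : MvPolynomial (Fin 3) ℝ} (hP : zeroSet P ⊆ closure (nonsingularPoints P)) {b q : E3}
    (hQ : (smallCube R q ∩ (smallBall R δ b ∩ wall R δ P)).Nonempty) :
    ∃ n : E3, ‖n‖ = 1 ∧ ∀ T : TubeIndex R, IsTangential γ δ P b T →
      (tube γ δ T ∩ smallCube R q).Nonempty →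
      |(inner ℝ (gridNormal γ R T.1) n : ℝ)| ≤ R ^ (-(1 / 2) + 2 * δ : ℝ) := by
  have hR0 : 0 < R := by linarith
  obtain ⟨p, hpQ, hpb, hpW⟩ := hQ
  obtain ⟨z, hzZ, hpz⟩ := Metric.mem_thickening_iff.1 hpW
  -- The thickening is defined by a strict inequality, which leaves room to move from `z` to a
  -- nonsingular point still within `R^(1/2+δ)` of `p`.
  obtain ⟨ξ₀, hξ₀, hzξ⟩ := Metric.mem_closure_iff.1 (hP hzZ) (R ^ (1 / 2 + δ : ℝ) - dist p z)
    (by linarith)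
  have hpξ : dist p ξ₀ ≤ R ^ (1 / 2 + δ : ℝ) := by linarith [dist_triangle p z ξ₀]
  have hs := rpow_half_le_rpow_half_add hR hδ
  have hρ1 : R ^ (1 / 2 + δ : ℝ) ≤ R := by
    simpa using Real.rpow_le_rpow_of_exponent_le hR (show 1 / 2 + δ ≤ 1 by linarith)
  have hρ2 : R ^ (1 / 2 + δ : ℝ) ≤ R ^ (1 - δ : ℝ) :=
    Real.rpow_le_rpow_of_exponent_le hR (by linarith)
  have hξB : ξ₀ ∈ dilatedBall R δ 2 b := by
    have h1 : dist p b ≤ 1 * R ^ (1 - δ : ℝ) := hpb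
    rw [dilatedBall, Metric.mem_closedBall]
    linarith [dist_triangle_left ξ₀ b p]
  have hg : ‖polyGradient P ξ₀‖ ≠ 0 := norm_ne_zero_iff.2 hξ₀.2
  refine ⟨‖polyGradient P ξ₀‖⁻¹ • polyGradient P ξ₀, ?_, fun T hT hTQ => ?_⟩
  · rw [norm_smul, norm_inv, norm_norm, inv_mul_cancel₀ hg]
  obtain ⟨ξ, hξT, hξQ⟩ := hTQ
  set ν := gridNormal γ R T.1 with hν
  have hν1 : ‖ν‖ = 1 := norm_gridNormal γ R T.1
  have hξξ₀ : ‖ξ₀ - ξ‖ ≤ 3 * R ^ (1 / 2 + δ : ℝ) := by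
    rw [← dist_eq_norm]
    have h1 := dist_center_le_of_mem_smallCube hR0 hξQ
    have h2 := dist_center_le_of_mem_smallCube hR0 hpQ
    have h3 := dist_triangle_left ξ₀ ξ p
    have h4 := dist_triangle_right p ξ q
    linarith
  have h10 : ξ₀ ∈ dilatedTube γ δ 10 T := by
    have ht1 : ‖ξ - T.2 - (inner ℝ ν (ξ - T.2) : ℝ) • ν‖ ≤ 1 * R ^ (1 / 2 + δ : ℝ) := hξT.1
    have ht2 : |(inner ℝ ν (ξ - T.2) : ℝ)| ≤ 1 * (4 * R) / 2 := hξT.2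
    have e : ξ₀ - T.2 = (ξ₀ - ξ) + (ξ - T.2) := by abel
    constructor
    · change ‖ξ₀ - T.2 - (inner ℝ ν (ξ₀ - T.2) : ℝ) • ν‖ ≤ 10 * R ^ (1 / 2 + δ : ℝ)
      have e2 : ξ₀ - T.2 - (inner ℝ ν (ξ₀ - T.2) : ℝ) • ν =
          (ξ₀ - ξ - (inner ℝ ν (ξ₀ - ξ) : ℝ) • ν) +
            (ξ - T.2 - (inner ℝ ν (ξ - T.2) : ℝ) • ν) := by
        rw [e, inner_add_right, add_smul]; abel
      rw [e2]
      have := norm_sub_inner_smul_le hν1 (ξ₀ - ξ)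
      refine (norm_add_le _ _).trans ?_
      have := Real.rpow_pos_of_pos hR0 (1 / 2 + δ)
      linarith
    · change |(inner ℝ ν (ξ₀ - T.2) : ℝ)| ≤ 10 * (4 * R) / 2
      rw [e, inner_add_right]
      have h1 := abs_real_inner_le_norm ν (ξ₀ - ξ)
      rw [hν1, one_mul] at h1
      refine (abs_add_le _ _).trans ?_
      linarith
  have hang := hT.2 ξ₀ hξ₀ ⟨hξB, h10⟩
  rw [angleToTangentPlane] at hang
  change |Real.pi / 2 - InnerProductGeometry.angle ν (polyGradient P ξ₀)| ≤ _ at hang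
  have hcos := InnerProductGeometry.cos_angle ν (polyGradient P ξ₀)
  rw [hν1, one_mul] at hcos
  -- The inner product with the unit normal is `cos` of the angle, that is `sin` of its complement,
  -- and `|sin t| ≤ |t|`.
  rw [real_inner_smul_right, inv_mul_eq_div, ← hcos, ← Real.sin_pi_div_two_sub]
  exact Real.abs_sin_le_abs.trans hang

end Tubes

/-! ### Elementary bounds for the extension operator -/

theorem norm_extension_le (γ : ℝ) (f : ℝ × ℝ → ℂ) (ξ : E3) :
    ‖extension γ f ξ‖ ≤ ∫ z, ‖f z‖ := by
  refine (norm_integral_le_integral_norm _).trans (le_of_eq ?_)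
  congr 1
  funext z
  rw [norm_mul, mul_comm Complex.I, Complex.norm_exp_ofReal_mul_I, mul_one]

theorem integral_norm_le_sqrt_sqNorm {f : ℝ × ℝ → ℂ} (hf : MemLp f 2 volume) {S : Set (ℝ × ℝ)}
    (hSm : MeasurableSet S) (hS : volume S ≤ 1) (hfS : ∀ z ∉ S, f z = 0) :
    ∫ z, ‖f z‖ ≤ √(sqNorm f) := by
  have hStop : volume S ≠ ⊤ := ne_top_of_le_ne_top ENNReal.one_ne_top hS
  have hfi : Integrable f volume := memLp_one_iff_integrable.1
    (hf.mono_exponent_of_measure_support_ne_top hfS hStop (by norm_num))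
  have hf2 : Integrable (fun z => ‖f z‖ ^ 2) volume := hf.integrable_norm_pow (by norm_num)
  have hind : Integrable (S.indicator fun _ => (1 : ℝ)) volume :=
    (integrable_indicator_iff hSm).2 (integrableOn_const hStop)
  set m := ∫ z, ‖f z‖ with hm
  have hvol : ∫ z, S.indicator (fun _ => (1 : ℝ)) z ≤ 1 := by
    rw [integral_indicator hSm, setIntegral_const, smul_eq_mul, mul_one]
    exact ENNReal.toReal_le_of_le_ofReal zero_le_one (by simpa using hS)
  -- Cauchy–Schwarz in the form `∫_S (|f| - m)² ≥ 0` with `m = ∫ |f|` and `|S| ≤ 1`.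
  have h0 : 0 ≤ ∫ z, (‖f z‖ ^ 2 - 2 * m * ‖f z‖ + m ^ 2 * S.indicator (fun _ => (1 : ℝ)) z) := by
    refine integral_nonneg fun z => ?_
    by_cases hz : z ∈ S
    · simp only [Pi.zero_apply, Set.indicator_of_mem hz]
      nlinarith [sq_nonneg (‖f z‖ - m)]
    · simp [hfS z hz, hz]
  have hi1 : Integrable (fun z => 2 * m * ‖f z‖) volume := hfi.norm.const_mul _
  have hi2 : Integrable (fun z => ‖f z‖ ^ 2 - 2 * m * ‖f z‖) volume := hf2.sub hi1
  rw [integral_add hi2 (hind.const_mul _), integral_sub hf2 hi1, integral_const_mul,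
    integral_const_mul, ← hm] at h0
  refine Real.le_sqrt_of_sq_le ?_
  change m ^ 2 ≤ ∫ z, ‖f z‖ ^ 2
  nlinarith [mul_le_mul_of_nonneg_left hvol (sq_nonneg m)]

theorem sqNorm_nonneg (f : ℝ × ℝ → ℂ) : 0 ≤ sqNorm f := integral_nonneg fun _ => by positivity

theorem square_eq_prod (c : ℝ × ℝ) (r : ℝ) :
    square c r = Set.Icc (c.1 - r / 2) (c.1 + r / 2) ×ˢ Set.Icc (c.2 - r / 2) (c.2 + r / 2) := by
  ext z
  simp only [square, Set.mem_ofPred_eq, Set.mem_prod, Set.mem_Icc, abs_le]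
  constructor <;> rintro ⟨⟨h1, h2⟩, h3, h4⟩ <;> refine ⟨⟨?_, ?_⟩, ?_, ?_⟩ <;> linarith

theorem measurableSet_square (c : ℝ × ℝ) (r : ℝ) : MeasurableSet (square c r) := by
  rw [square_eq_prod]; exact measurableSet_Icc.prod measurableSet_Icc

theorem volume_square_le_one (c : ℝ × ℝ) {r : ℝ} (hr : r ≤ 1) : volume (square c r) ≤ 1 := by
  rw [square_eq_prod, Measure.volume_eq_prod, Measure.prod_prod, Real.volume_Icc, Real.volume_Icc]
  have h : ∀ t : ℝ, ENNReal.ofReal (t + r / 2 - (t - r / 2)) ≤ 1 := fun t => by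
    rw [ENNReal.ofReal_le_one]; linarith
  exact mul_le_one' (h _) (h _)

/-! ### The tubes that contribute on a small cube -/

section MainPart

variable {γ R δ A : ℝ} {𝕋 : TubeFamily γ R} {f : ℝ × ℝ → ℂ} {g : TubeIndex R → ℝ × ℝ → ℂ}

theorem tripleSquare_side_le (hR : 9 ≤ R) : 3 * R ^ (-(1 / 2) : ℝ) ≤ 1 := by
  have h : R ^ (-(1 / 2) : ℝ) ≤ (9 : ℝ) ^ (-(1 / 2) : ℝ) :=
    Real.rpow_le_rpow_of_nonpos (by norm_num) hR (by norm_num)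
  have h9 : (9 : ℝ) ^ (-(1 / 2) : ℝ) = 1 / 3 := by
    rw [show (9 : ℝ) = 3 ^ (2 : ℝ) by norm_num, ← Real.rpow_mul (by norm_num)]; norm_num
  linarith

theorem IsWavePacketDecomposition.integrable (hW : IsWavePacketDecomposition δ A 𝕋 f g)
    (hR : 9 ≤ R) {T : TubeIndex R} (hT : T ∈ 𝕋.tubes) : Integrable (g T) volume :=
  memLp_one_iff_integrable.1 ((hW.memLp T hT).mono_exponent_of_measure_support_ne_top
    (hW.support T hT) (ne_top_of_le_ne_top ENNReal.one_ne_top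
      (volume_square_le_one _ (tripleSquare_side_le hR))) (by norm_num))

theorem IsWavePacketDecomposition.norm_extension_le (hW : IsWavePacketDecomposition δ A 𝕋 f g)
    (hR : 9 ≤ R) {T : TubeIndex R} (hT : T ∈ 𝕋.tubes) (ξ : E3) :
    ‖extension γ (g T) ξ‖ ≤ √(sqNorm (g T)) :=
  (SaddleExtension.norm_extension_le γ _ ξ).trans (integral_norm_le_sqrt_sqNorm (hW.memLp T hT)
    (measurableSet_square _ _) (volume_square_le_one _ (tripleSquare_side_le hR))
    (hW.support T hT))

theorem IsWavePacketDecomposition.sqNorm_le_setIntegral (hW : IsWavePacketDecomposition δ A 𝕋 f g)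
    {T : TubeIndex R} (hT : T ∈ 𝕋.tubes) :
    sqNorm (g T) ≤ A * ∫ z in tripleSquare R T.1, ‖f z‖ ^ 2 := by
  have hT2 : T.2 ∈ 𝕋.centers T.1 := (Finset.mem_sigma.1 hT).2
  exact (Finset.single_le_sum (f := fun a => sqNorm (g ⟨T.1, a⟩)) (fun a _ => sqNorm_nonneg _)
    hT2).trans (hW.square_sum T.1)

theorem IsWavePacketDecomposition.sqNorm_le (hW : IsWavePacketDecomposition δ A 𝕋 f g)
    (hf : MemLp f 2 volume) {T : TubeIndex R} (hT : T ∈ 𝕋.tubes) :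
    sqNorm (g T) ≤ max A 1 * sqNorm f := by
  have h0 : 0 ≤ ∫ z in tripleSquare R T.1, ‖f z‖ ^ 2 := integral_nonneg fun _ => by positivity
  -- The maximum with 1 keeps the constant nonnegative for every real `A`.
  refine (hW.sqNorm_le_setIntegral hT).trans
    (mul_le_mul (le_max_left _ _) ?_ h0 (zero_le_one.trans (le_max_right _ _)))
  exact setIntegral_le_integral (hf.integrable_norm_pow (by norm_num))
    (Filter.Eventually.of_forall fun _ => by positivity)

/-- If `3θ` misses `τ`, the square function bound forces `‖f_T‖₂ = 0`. Such packets can be discarded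
exactly, which keeps the contributing part supported near its cap. -/
theorem IsWavePacketDecomposition.extension_eq_zero (hW : IsWavePacketDecomposition δ A 𝕋 f g)
    (hR : 9 ≤ R) {τ : Set (ℝ × ℝ)} (hτ : ∀ z ∉ τ, f z = 0) {T : TubeIndex R} (hT : T ∈ 𝕋.tubes)
    (hdisj : ¬ (tripleSquare R T.1 ∩ τ).Nonempty) (ξ : E3) : extension γ (g T) ξ = 0 := by
  have h0 : ∫ z in tripleSquare R T.1, ‖f z‖ ^ 2 = 0 := by
    have : Set.EqOn (fun z => ‖f z‖ ^ 2) (fun _ => (0 : ℝ)) (tripleSquare R T.1) := fun z hz => by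
      have : f z = 0 := hτ z fun h => hdisj ⟨z, hz, h⟩
      simp [this]
    exact (setIntegral_congr_fun (measurableSet_square _ _) this).trans (by simp)
  have h1 := hW.sqNorm_le_setIntegral hT
  rw [h0, mul_zero] at h1
  have h2 := hW.norm_extension_le hR hT ξ
  rw [Real.sqrt_eq_zero_of_nonpos h1] at h2
  exact norm_le_zero_iff.1 h2

open Classical in
/-- The tangential tubes that meet `Q ∩ B_R` and come from a square `θ` with `3θ` meeting `τ`. -/
def contributingTubes (δ : ℝ) (𝕋 : TubeFamily γ R) (P : MvPolynomial (Fin 3) ℝ) (b q : E3)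
    (τ : Set (ℝ × ℝ)) : Finset (TubeIndex R) :=
  (tangTubes δ 𝕋 P b).filter fun T => (tube γ δ T ∩ (smallCube R q ∩ bigCube R)).Nonempty ∧
    (tripleSquare R T.1 ∩ τ).Nonempty

/-- The sum of the wave packets that contribute on `Q ∩ B_R`. -/
def contributingPart (δ : ℝ) (𝕋 : TubeFamily γ R) (P : MvPolynomial (Fin 3) ℝ) (b q : E3)
    (τ : Set (ℝ × ℝ)) (g : TubeIndex R → ℝ × ℝ → ℂ) (z : ℝ × ℝ) : ℂ :=
  ∑ T ∈ contributingTubes δ 𝕋 P b q τ, g T z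

variable {P : MvPolynomial (Fin 3) ℝ} {b q : E3} {τ : Set (ℝ × ℝ)}

theorem mem_contributingTubes {T : TubeIndex R} : T ∈ contributingTubes δ 𝕋 P b q τ ↔
    T ∈ tangTubes δ 𝕋 P b ∧ (tube γ δ T ∩ (smallCube R q ∩ bigCube R)).Nonempty ∧
    (tripleSquare R T.1 ∩ τ).Nonempty := by
  simp [contributingTubes]

theorem tangTubes_subset : tangTubes δ 𝕋 P b ⊆ 𝕋.tubes := by
  classical
  exact Finset.filter_subset _ _

theorem contributingTubes_subset : contributingTubes δ 𝕋 P b q τ ⊆ tangTubes δ 𝕋 P b := by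
  classical
  exact Finset.filter_subset _ _

theorem tube_subset_dilatedTube (hR : 0 < R) (T : TubeIndex R) :
    tube γ δ T ⊆ dilatedTube γ δ 10 T := by
  intro ξ hξ
  have hp := Real.rpow_pos_of_pos hR (1 / 2 + δ)
  obtain ⟨h1, h2⟩ := hξ
  exact ⟨h1.trans (by linarith), h2.trans (by linarith)⟩

theorem contributingTubes_subset_tangTubesAt (hR : 0 < R) :
    contributingTubes δ 𝕋 P b q τ ⊆ tangTubesAt δ 𝕋 P b q := by
  intro T hT
  obtain ⟨h1, ⟨ξ, hξT, hξQ, -⟩, -⟩ := mem_contributingTubes.1 hT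
  simp only [tangTubesAt, Finset.mem_filter]
  exact ⟨h1, ξ, tube_subset_dilatedTube hR T hξT, hξQ⟩

theorem IsWavePacketDecomposition.extension_sum (hW : IsWavePacketDecomposition δ A 𝕋 f g)
    (hR : 9 ≤ R) {s : Finset (TubeIndex R)} (hs : s ⊆ 𝕋.tubes) (ξ : E3) :
    extension γ (fun z => ∑ T ∈ s, g T z) ξ = ∑ T ∈ s, extension γ (g T) ξ := by
  simp only [extension, Finset.sum_mul]
  refine integral_finsetSum _ fun T hT => ?_
  have hi := hW.integrable hR (hs hT)
  refine hi.mono (hi.1.mul (Continuous.aestronglyMeasurable ?_))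
    (Filter.Eventually.of_forall fun z => ?_)
  · unfold phase; fun_prop
  · rw [norm_mul, mul_comm Complex.I, Complex.norm_exp_ofReal_mul_I, mul_one]

theorem IsWavePacketDecomposition.memLp_contributingPart
    (hW : IsWavePacketDecomposition δ A 𝕋 f g) :
    MemLp (contributingPart δ 𝕋 P b q τ g) 2 volume :=
  memLp_finsetSum _ fun T hT => hW.memLp T (tangTubes_subset (contributingTubes_subset hT))

theorem IsWavePacketDecomposition.integrable_contributingPart
    (hW : IsWavePacketDecomposition δ A 𝕋 f g) (hR : 9 ≤ R) :
    Integrable (contributingPart δ 𝕋 P b q τ g) volume :=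
  integrable_finsetSum _ fun _ hT =>
    hW.integrable hR (tangTubes_subset (contributingTubes_subset hT))

/-- A discarded tube either does not contain `ξ`, where the packet decays, or comes from a square
away from `τ`, where its extension vanishes. -/
theorem IsWavePacketDecomposition.norm_extension_tangPart_le
    (hW : IsWavePacketDecomposition δ A 𝕋 f g) (hR : 9 ≤ R) (hτ : ∀ z ∉ τ, f z = 0) {ξ : E3}
    (hξ : ξ ∈ smallCube R q ∩ bigCube R) :
    ‖extension γ (tangPart δ 𝕋 P b g) ξ‖ ≤ ‖extension γ (contributingPart δ 𝕋 P b q τ g) ξ‖ +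
      (tangTubes δ 𝕋 P b).card * (R ^ (-1000 : ℝ) * √(sqNorm f)) := by
  classical
  have hR0 : 0 < R := by linarith
  have h1 : extension γ (tangPart δ 𝕋 P b g) ξ = _ := hW.extension_sum hR tangTubes_subset ξ
  have h2 : extension γ (contributingPart δ 𝕋 P b q τ g) ξ = _ :=
    hW.extension_sum hR (contributingTubes_subset.trans tangTubes_subset) ξ
  rw [h1, h2, ← Finset.sum_sdiff (contributingTubes_subset (q := q) (τ := τ)), add_comm]
  refine (norm_add_le _ _).trans (add_le_add le_rfl ?_)
  refine (norm_sum_le_of_le _ (f := fun T => extension γ (g T) ξ)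
    (n := fun _ => R ^ (-1000 : ℝ) * √(sqNorm f)) fun T hT => ?_).trans ?_
  · obtain ⟨hT1, hT2⟩ := Finset.mem_sdiff.1 hT
    have hTt := tangTubes_subset hT1
    by_cases hd : (tripleSquare R T.1 ∩ τ).Nonempty
    · refine hW.decay T hTt ξ ⟨hξ.2, fun hξT => hT2 ?_⟩
      exact mem_contributingTubes.2 ⟨hT1, ⟨ξ, hξT, hξ⟩, hd⟩
    · rw [hW.extension_eq_zero hR hτ hTt hd, norm_zero]
      positivity
  · rw [Finset.sum_const, nsmul_eq_mul]
    gcongr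
    exact Finset.sdiff_subset

theorem IsWavePacketDecomposition.norm_extension_contributingPart_le
    (hW : IsWavePacketDecomposition δ A 𝕋 f g) (hR : 9 ≤ R) (hf : MemLp f 2 volume) (ξ : E3) :
    ‖extension γ (contributingPart δ 𝕋 P b q τ g) ξ‖ ≤
      (tangTubes δ 𝕋 P b).card * √(max A 1 * sqNorm f) := by
  have h2 : extension γ (contributingPart δ 𝕋 P b q τ g) ξ = _ :=
    hW.extension_sum hR (contributingTubes_subset.trans tangTubes_subset) ξ
  rw [h2]
  refine (norm_sum_le_of_le _ (f := fun T => extension γ (g T) ξ)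
    (n := fun _ => √(max A 1 * sqNorm f)) fun T hT => ?_).trans ?_
  · have hTt := tangTubes_subset (contributingTubes_subset hT)
    exact (hW.norm_extension_le hR hTt ξ).trans (Real.sqrt_le_sqrt (hW.sqNorm_le hf hTt))
  · rw [Finset.sum_const, nsmul_eq_mul]
    gcongr
    exact contributingTubes_subset

/-- Pointwise Cauchy–Schwarz: at a given `z` only the tubes through `Q` with `z` in `3θ` enter the
sum, and these are counted by `card_overlap_le`. -/
theorem IsWavePacketDecomposition.sqNorm_contributingPart_le
    (hW : IsWavePacketDecomposition δ A 𝕋 f g) (hR : 1 ≤ R) (hδ : 0 ≤ δ) :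
    sqNorm (contributingPart δ 𝕋 P b q τ g) ≤
      16 * (11 * R ^ δ) ^ 3 * ∑ T ∈ tangTubesAt δ 𝕋 P b q, sqNorm (g T) := by
  classical
  set s := contributingTubes δ 𝕋 P b q τ with hs
  have hint : ∀ T ∈ s, Integrable (fun z => ‖g T z‖ ^ 2) volume := fun T hT =>
    (hW.memLp T (tangTubes_subset (contributingTubes_subset hT))).integrable_norm_pow (by norm_num)
  have hpt : ∀ z, ‖contributingPart δ 𝕋 P b q τ g z‖ ^ 2 ≤
      16 * (11 * R ^ δ) ^ 3 * ∑ T ∈ s, ‖g T z‖ ^ 2 := by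
    intro z
    set u := s.filter fun T => g T z ≠ 0 with hu
    have hus : ∀ T ∈ u, T ∈ s ∧ g T z ≠ 0 := fun T hT => Finset.mem_filter.1 hT
    have h1 : contributingPart δ 𝕋 P b q τ g z = ∑ T ∈ u, g T z :=
      (Finset.sum_filter_ne_zero s).symm
    have hcard : (u.card : ℝ) ≤ 16 * (11 * R ^ δ) ^ 3 := by
      refine card_overlap_le (q := q) hR hδ 𝕋 z (fun T hT => ?_) (fun T hT => ?_) fun T hT => ?_
      · exact (mem_tangTubes.1 (contributingTubes_subset (hus T hT).1)).1
      · obtain ⟨-, ⟨ξ, h1, h2, -⟩, -⟩ := mem_contributingTubes.1 (hus T hT).1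
        exact ⟨ξ, h1, h2⟩
      · by_contra hz
        exact (hus T hT).2 (hW.support T (tangTubes_subset (contributingTubes_subset
          (hus T hT).1)) z hz)
    rw [h1]
    calc ‖∑ T ∈ u, g T z‖ ^ 2 ≤ (∑ T ∈ u, ‖g T z‖) ^ 2 := by
          gcongr; exact norm_sum_le _ _
      _ ≤ u.card * ∑ T ∈ u, ‖g T z‖ ^ 2 := sq_sum_le_card_mul_sum_sq
      _ ≤ 16 * (11 * R ^ δ) ^ 3 * ∑ T ∈ s, ‖g T z‖ ^ 2 := by
          gcongr
          exact Finset.filter_subset _ _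
  calc sqNorm (contributingPart δ 𝕋 P b q τ g)
      ≤ ∫ z, 16 * (11 * R ^ δ) ^ 3 * ∑ T ∈ s, ‖g T z‖ ^ 2 :=
        integral_mono_of_nonneg (Filter.Eventually.of_forall fun _ => by positivity)
          ((integrable_finsetSum _ hint).const_mul _) (Filter.Eventually.of_forall hpt)
    _ = 16 * (11 * R ^ δ) ^ 3 * ∑ T ∈ s, sqNorm (g T) := by
        rw [integral_const_mul, integral_finsetSum _ hint]
        rfl
    _ ≤ _ := by
        gcongr
        · exact fun T _ _ => sqNorm_nonneg _
        · exact contributingTubes_subset_tangTubesAt (by linarith)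

theorem IsWavePacketDecomposition.exists_of_contributingPart_ne_zero
    (hW : IsWavePacketDecomposition δ A 𝕋 f g) {z : ℝ × ℝ}
    (hz : contributingPart δ 𝕋 P b q τ g z ≠ 0) :
    ∃ T ∈ contributingTubes δ 𝕋 P b q τ, z ∈ tripleSquare R T.1 := by
  obtain ⟨T, hT, hne⟩ := Finset.exists_ne_zero_of_sum_ne_zero hz
  refine ⟨T, hT, ?_⟩
  by_contra h
  exact hne (hW.support T (tangTubes_subset (contributingTubes_subset hT)) z h)

end MainPart

/-! ### The geometry of the supports -/

/-- Points near two strongly separated caps are separated and transversal. -/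
theorem separated_of_stronglySeparated {γ h t : ℝ} {c₁ c₂ z₁ z₂ : ℝ × ℝ} (hγ : |γ| ≤ 1)
    (ht0 : 0 ≤ t) (ht : t ≤ 53 / 100 * h)
    (hsep : 10 * h ≤ min |c₂.2 - c₁.2|
      (max |transversality γ c₁ c₁ c₂| |transversality γ c₂ c₁ c₂|))
    (hz₁ : |z₁.2| ≤ 11 / 10) (hz₂ : |z₂.2| ≤ 11 / 10)
    (h₁ : |z₁.1 - c₁.1| ≤ t ∧ |z₁.2 - c₁.2| ≤ t) (h₂ : |z₂.1 - c₂.1| ≤ t ∧ |z₂.2 - c₂.2| ≤ t) :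
    h ≤ |z₂.2 - z₁.2| ∧ h ≤ max |transversality γ z₁ z₁ z₂| |transversality γ z₂ z₁ z₂| := by
  have hh : 0 ≤ h := by linarith
  obtain ⟨hy, htr⟩ := le_min_iff.1 hsep
  have hdy : |(c₂.2 - c₁.2) - (z₂.2 - z₁.2)| ≤ 106 / 100 * h := by
    have e : (c₂.2 - c₁.2) - (z₂.2 - z₁.2) = (z₁.2 - c₁.2) - (z₂.2 - c₂.2) := by ring
    rw [e]; exact (abs_sub _ _).trans (by linarith [h₁.2, h₂.2])
  have hdx : |(c₂.1 - c₁.1) - (z₂.1 - z₁.1)| ≤ 106 / 100 * h := by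
    have e : (c₂.1 - c₁.1) - (z₂.1 - z₁.1) = (z₁.1 - c₁.1) - (z₂.1 - c₂.1) := by ring
    rw [e]; exact (abs_sub _ _).trans (by linarith [h₁.1, h₂.1])
  have hzy : |z₂.2 - z₁.2| ≤ 22 / 10 := (abs_sub _ _).trans (by linarith)
  have htri := abs_sub_abs_le_abs_sub (c₂.2 - c₁.2) (z₂.2 - z₁.2)
  have hyz : h ≤ |z₂.2 - z₁.2| := by linarith
  -- Neither `h` nor the centers are bounded a priori. The inequality `10h ≤ |c₂.2 - c₁.2| ≤ 22/10 +
  -- (106/100)h` bounds both `h` and the gap.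
  have hcy : |c₂.2 - c₁.2| ≤ 25 / 10 := by linarith
  refine ⟨hyz, ?_⟩
  -- Passing from centers to points changes the transversality by less than `4h`, out of `10h`.
  have hdiff : ∀ y v c₀ z₀ : ℝ, |y| ≤ 11 / 10 → |y - v| ≤ t →
      c₀ = c₂.1 - c₁.1 + γ * v * (c₂.2 - c₁.2) → z₀ = z₂.1 - z₁.1 + γ * y * (z₂.2 - z₁.2) →
      10 * h ≤ |c₀| → h ≤ |z₀| := by
    intro y v c₀ z₀ hy hyv hc₀ hz₀ h10
    have e : c₀ - z₀ = ((c₂.1 - c₁.1) - (z₂.1 - z₁.1)) + γ * (y *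
        ((c₂.2 - c₁.2) - (z₂.2 - z₁.2)) - (y - v) * (c₂.2 - c₁.2)) := by
      rw [hc₀, hz₀]; ring
    have b1 := abs_mul_le_mul hy hdy
    have b2 := abs_mul_le_mul hyv hcy
    have b3 := abs_mul_le_mul hγ ((abs_sub _ _).trans (add_le_add b1 b2))
    have b4 : |c₀ - z₀| ≤ _ := e ▸ (abs_add_le _ _).trans (add_le_add hdx b3)
    have b5 := abs_sub_abs_le_abs_sub c₀ z₀
    linarith
  rcases le_max_iff.1 htr with h' | h'
  · exact le_max_of_le_left (hdiff z₂.2 c₂.2 _ _ hz₂ h₂.2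
      (by simp only [transversality]; ring) (by simp only [transversality]; ring) h')
  · exact le_max_of_le_right (hdiff z₁.2 c₁.2 _ _ hz₁ h₁.2
      (by simp only [transversality]; ring) (by simp only [transversality]; ring) h')

/-- A square `3θ` whose normal is nearly orthogonal to `n` lies in a strip. -/
theorem mem_strip_of_mem_tripleSquare {γ R ρ : ℝ} (hγ : |γ| ≤ 1) {θ : GridIndex R} {n : E3}
    (hn : ‖n‖ = 1) (hρ0 : 0 ≤ ρ) (hρ : R ^ (-(1 / 2) : ℝ) ≤ ρ)
    (hθ : |(inner ℝ (gridNormal γ R θ) n : ℝ)| ≤ ρ) {z : ℝ × ℝ} (hz : z ∈ tripleSquare R θ)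
    (hz2 : |z.2| ≤ 11 / 10) (hω1 : |(gridCenter R θ).1| ≤ 11 / 10)
    (hω2 : |(gridCenter R θ).2| ≤ 11 / 10) :
    |n 0 * z.2 + n 1 * (z.1 + γ * z.2 ^ 2) - n 2| ≤ 10 * ρ := by
  set ω := gridCenter R θ with hω
  have hni : ∀ i, |n i| ≤ 1 := fun i => by
    have := PiLp.norm_apply_le n i
    rwa [hn] at this
  have hN0 : (0 : ℝ) < ‖normal γ ω‖ := by linarith [one_le_norm_normal γ ω]
  have hN : ‖normal γ ω‖ ≤ 3 := by
    refine le_of_sq_le_sq ?_ (by norm_num)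
    rw [EuclideanSpace.norm_sq_eq, Fin.sum_univ_three]
    simp only [normal, Real.norm_eq_abs, sq_abs]
    change ω.2 ^ 2 + (ω.1 + γ * ω.2 ^ 2) ^ 2 + (-1 : ℝ) ^ 2 ≤ 3 ^ 2
    have h1 := abs_mul_le_mul hω2 hω2
    have h2 := abs_mul_le_mul hγ h1
    rw [← sq] at h1 h2
    have h3 : |ω.1 + γ * ω.2 ^ 2| ≤ 231 / 100 := (abs_add_le _ _).trans (by linarith)
    have h4 := abs_mul_le_mul h3 h3
    rw [← sq] at h4
    have h5 := le_abs_self (ω.2 ^ 2)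
    have h6 := le_abs_self ((ω.1 + γ * ω.2 ^ 2) ^ 2)
    linarith
  have hin : |n 0 * ω.2 + n 1 * (ω.1 + γ * ω.2 ^ 2) - n 2| ≤ 3 * ρ := by
    have e : (inner ℝ (gridNormal γ R θ) n : ℝ) =
        ‖normal γ ω‖⁻¹ * (n 0 * ω.2 + n 1 * (ω.1 + γ * ω.2 ^ 2) - n 2) := by
      rw [gridNormal, unitNormal, real_inner_smul_left]
      congr 1
      simp [normal, PiLp.inner_apply, Fin.sum_univ_three]
      ring
    rw [e, abs_mul, abs_inv, abs_norm, inv_mul_le_iff₀ hN0] at hθ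
    refine hθ.trans ?_
    gcongr
  obtain ⟨d1, d2⟩ := hz
  have d2' := abs_mul_le_mul hγ (abs_mul_le_mul d2
    ((abs_add_le z.2 ω.2).trans (add_le_add hz2 hω2)))
  have e : n 0 * z.2 + n 1 * (z.1 + γ * z.2 ^ 2) - n 2 =
      (n 0 * ω.2 + n 1 * (ω.1 + γ * ω.2 ^ 2) - n 2) + (n 0 * (z.2 - ω.2) +
        n 1 * ((z.1 - ω.1) + γ * ((z.2 - ω.2) * (z.2 + ω.2)))) := by ring
  have b1 := abs_mul_le_mul (hni 0) d2
  have b2 := abs_mul_le_mul (hni 1) ((abs_add_le _ _).trans (add_le_add d1 d2'))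
  -- At the center of `θ` the bound is `3ρ`, as the normal has length at most 3. Moving to `z`, at
  -- most `(3/2)ρ` away in each coordinate, costs at most `6.3ρ`.
  rw [e]
  refine (abs_add_le _ _).trans ((add_le_add hin ((abs_add_le _ _).trans
    (add_le_add b1 b2))).trans ?_)
  linarith

/-- Two points of `3θ` differ by at most `3R^(-1/2) ≤ (3/100)h` per coordinate; half the side of the
cap adds `h/2`, giving `53/100`. The same slack around `[0,1]` gives `11/10`. -/
theorem near_of_mem_tripleSquare {R h c₁ c₂ r : ℝ} {θ : GridIndex R} {z : ℝ × ℝ}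
    (hη : 100 * R ^ (-(1 / 2) : ℝ) ≤ h) (hη1 : 100 * R ^ (-(1 / 2) : ℝ) ≤ 1)
    (hR : 0 < R) (hr : r ≤ h)
    (hz : z ∈ tripleSquare R θ) (hτ : (tripleSquare R θ ∩ cap (c₁, c₂) r).Nonempty) :
    (|z.1 - c₁| ≤ 53 / 100 * h ∧ |z.2 - c₂| ≤ 53 / 100 * h) ∧
    (|z.1| ≤ 11 / 10 ∧ |z.2| ≤ 11 / 10) ∧
    |(gridCenter R θ).1| ≤ 11 / 10 ∧ |(gridCenter R θ).2| ≤ 11 / 10 := by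
  have hη0 : 0 ≤ R ^ (-(1 / 2) : ℝ) := (Real.rpow_pos_of_pos hR _).le
  obtain ⟨w, ⟨hw1, hw2⟩, ⟨hc1, hc2⟩, ⟨⟨hs1, hs2⟩, hs3, hs4⟩⟩ := hτ
  obtain ⟨hz1, hz2⟩ := hz
  simp only [abs_le] at *
  refine ⟨⟨⟨?_, ?_⟩, ?_, ?_⟩, ⟨⟨?_, ?_⟩, ?_, ?_⟩, ⟨?_, ?_⟩, ?_, ?_⟩ <;> linarith

/-- On the supports of the contributing parts the map `(z₁, z₂) ↦ Φ(z₁) + Φ(z₂)` is injective up to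
a scale close to `R^{-1/2}`. -/
theorem contributing_separation {γ R δ μ κ r₁ r₂ A : ℝ} {c₁ c₂ : ℝ × ℝ} {𝕋 : TubeFamily γ R}
    {P : MvPolynomial (Fin 3) ℝ} {b q n : E3} {f₁ f₂ : ℝ × ℝ → ℂ}
    {g₁ g₂ : TubeIndex R → ℝ × ℝ → ℂ} (hγ : |γ| ≤ 1) (hδ : 0 ≤ δ) (hR : 1 ≤ R) (hκ : 0 < κ)
    (hκ1 : κ ≤ 1) (hμ : 1 ≤ μ) (hη : 100 * R ^ (-(1 / 2) : ℝ) ≤ κ)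
    (hρκ : 10 * R ^ (-(1 / 2) + 2 * δ : ℝ) ≤ κ ^ 2 / 2000)
    (hr₁ : r₁ ≤ μ ^ (1 / 2 : ℝ) * κ) (hr₂ : r₂ ≤ μ ^ (1 / 2 : ℝ) * κ)
    (hsep : 10 * μ ^ (1 / 2 : ℝ) * κ ≤ min |c₂.2 - c₁.2|
      (max |transversality γ c₁ c₁ c₂| |transversality γ c₂ c₁ c₂|))
    (hn : ‖n‖ = 1) (hnT : ∀ T : TubeIndex R, IsTangential γ δ P b T →
      (tube γ δ T ∩ smallCube R q).Nonempty →
      |(inner ℝ (gridNormal γ R T.1) n : ℝ)| ≤ R ^ (-(1 / 2) + 2 * δ : ℝ))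
    (hW₁ : IsWavePacketDecomposition δ A 𝕋 f₁ g₁) (hW₂ : IsWavePacketDecomposition δ A 𝕋 f₂ g₂)
    (w w' : (ℝ × ℝ) × (ℝ × ℝ))
    (h₁ : contributingPart δ 𝕋 P b q (cap c₁ r₁) g₁ w.1 ≠ 0)
    (h₂ : contributingPart δ 𝕋 P b q (cap c₂ r₂) g₂ w.2 ≠ 0)
    (h₁' : contributingPart δ 𝕋 P b q (cap c₁ r₁) g₁ w'.1 ≠ 0)
    (h₂' : contributingPart δ 𝕋 P b q (cap c₂ r₂) g₂ w'.2 ≠ 0) :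
    dist w w' ≤ 4 ∧ (‖surfacePoint γ w.1 + surfacePoint γ w.2 -
        (surfacePoint γ w'.1 + surfacePoint γ w'.2)‖ ≤ R ^ (-(1 / 2) + δ : ℝ) →
      dist w w' ≤ 20000 * (10 * R ^ (-(1 / 2) + 2 * δ : ℝ)) / κ ^ 4) := by
  have hR0 : 0 < R := by linarith
  have hη0 : 0 < R ^ (-(1 / 2) : ℝ) := Real.rpow_pos_of_pos hR0 _
  have hηρ : R ^ (-(1 / 2) : ℝ) ≤ R ^ (-(1 / 2) + 2 * δ : ℝ) :=
    Real.rpow_le_rpow_of_exponent_le hR (by linarith)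
  have hdρ : R ^ (-(1 / 2) + δ : ℝ) ≤ R ^ (-(1 / 2) + 2 * δ : ℝ) :=
    Real.rpow_le_rpow_of_exponent_le hR (by linarith)
  set h := μ ^ (1 / 2 : ℝ) * κ with hh
  have hκh : κ ≤ h := le_mul_of_one_le_left hκ.le (Real.one_le_rpow hμ (by norm_num))
  have hsup : ∀ {f : ℝ × ℝ → ℂ} {g : TubeIndex R → ℝ × ℝ → ℂ} {c : ℝ × ℝ} {r : ℝ} {z : ℝ × ℝ},
      IsWavePacketDecomposition δ A 𝕋 f g → r ≤ h →
      contributingPart δ 𝕋 P b q (cap c r) g z ≠ 0 →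
      (|z.1 - c.1| ≤ 53 / 100 * h ∧ |z.2 - c.2| ≤ 53 / 100 * h) ∧
      (|z.1| ≤ 11 / 10 ∧ |z.2| ≤ 11 / 10) ∧
      |n 0 * z.2 + n 1 * (z.1 + γ * z.2 ^ 2) - n 2| ≤ 10 * R ^ (-(1 / 2) + 2 * δ : ℝ) := by
    intro f g c r z hW hr hz
    obtain ⟨T, hT, hzT⟩ := hW.exists_of_contributingPart_ne_zero hz
    obtain ⟨ht, ⟨ξ, hξ1, hξ2, -⟩, hcap⟩ := mem_contributingTubes.1 hT
    obtain ⟨k1, k2, k3, k4⟩ := near_of_mem_tripleSquare (hη.trans hκh) (hη.trans hκ1) hR0 hr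
      hzT hcap
    exact ⟨k1, k2, mem_strip_of_mem_tripleSquare hγ hn (hη0.le.trans hηρ) hηρ
      (hnT T (mem_tangTubes.1 ht).2 ⟨ξ, hξ1, hξ2⟩) hzT k2.2 k3 k4⟩
  obtain ⟨a1, a2, a3⟩ := hsup hW₁ hr₁ h₁
  obtain ⟨b1, b2, b3⟩ := hsup hW₂ hr₂ h₂
  obtain ⟨a1', a2', a3'⟩ := hsup hW₁ hr₁ h₁'
  obtain ⟨b1', b2', b3'⟩ := hsup hW₂ hr₂ h₂'
  have hsep' : 10 * h ≤ min |c₂.2 - c₁.2|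
      (max |transversality γ c₁ c₁ c₂| |transversality γ c₂ c₁ c₂|) := by
    rw [hh, ← mul_assoc]; exact hsep
  have ht0 : 0 ≤ 53 / 100 * h := by linarith
  obtain ⟨s1, s2⟩ := separated_of_stronglySeparated hγ ht0 le_rfl hsep' a2.2 b2.2 a1 b1
  -- The mixed pair, first point from `w'` and second from `w`, supplies the separation that
  -- excludes the swap.
  obtain ⟨s1', -⟩ := separated_of_stronglySeparated hγ ht0 le_rfl hsep' a2'.2 b2.2 a1' b1
  refine ⟨?_, fun hd => ?_⟩
  · simp only [Prod.dist_eq, Real.dist_eq, max_le_iff]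
    refine ⟨⟨?_, ?_⟩, ?_, ?_⟩ <;> refine (abs_sub _ _).trans ?_
    · linarith [a2.1, a2'.1]
    · linarith [a2.2, a2'.2]
    · linarith [b2.1, b2'.1]
    · linarith [b2.2, b2'.2]
  · have hcoord : ∀ i, |(surfacePoint γ w.1 + surfacePoint γ w.2 -
        (surfacePoint γ w'.1 + surfacePoint γ w'.2)) i| ≤ 10 * R ^ (-(1 / 2) + 2 * δ : ℝ) :=
      fun i => by
        have := PiLp.norm_apply_le (surfacePoint γ w.1 + surfacePoint γ w.2 -
          (surfacePoint γ w'.1 + surfacePoint γ w'.2)) i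
        rw [Real.norm_eq_abs] at this
        linarith
    have hn2 : n 1 ^ 2 + n 0 ^ 2 + n 2 ^ 2 = 1 := by
      have := EuclideanSpace.norm_sq_eq n
      rw [hn, Fin.sum_univ_three] at this
      simp only [Real.norm_eq_abs, sq_abs] at this
      linarith
    exact strip_rigidity hγ hκ hκ1 (by linarith) hρκ (by linarith) a2 b2 a2' b2'
      (hκh.trans s1) (by rw [abs_sub_comm]; exact hκh.trans s1') (hκh.trans s2) a3 b3 a3' b3'
      (hcoord 0) (hcoord 1) (hcoord 2)

/-! ### Numerical bounds for large `R` -/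

/-- Power counting: `R^(3/2)` from the Gaussian, `R^(-2+8δ)` from Schur's test and `R^(6δ)` from the
overlap give `R^(-1/2+14δ)`. The remaining `R^(6δ)` absorbs the constant, including `κ^(-16)`. -/
theorem eventually_main_constant_le {δ κ : ℝ} (hδ : 0 < δ) (hκ : 0 < κ) (hκ1 : κ ≤ 1) :
    ∀ᶠ R : ℝ in Filter.atTop,
      4 * (3 * (Real.pi * R) ^ (3 / 2 : ℝ) *
        (2 * ((2 * (20000 * (10 * R ^ (-(1 / 2) + 2 * δ : ℝ)) / κ ^ 4)) ^ 4 +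
          8 ^ 4 * Real.exp (-(R * (R ^ (-(1 / 2) + δ : ℝ)) ^ 2 / 4))))) *
        (16 * (11 * R ^ δ) ^ 3) ^ 2 ≤ R ^ (20 * δ : ℝ) * R ^ (-(1 / 2) : ℝ) := by
  -- With `t = R^(2δ)`, exponential decay in `t` beats `t^(-1/δ) = R^(-2)`.
  have hexp : ∀ᶠ R : ℝ in Filter.atTop, Real.exp (-(1 / 4) * R ^ (2 * δ)) ≤ R ^ (-2 : ℝ) := by
    have h1 := (isLittleO_exp_neg_mul_rpow_atTop (show (0 : ℝ) < 1 / 4 by norm_num)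
      (-δ⁻¹)).comp_tendsto (tendsto_rpow_atTop (show 0 < 2 * δ by positivity))
    filter_upwards [h1.bound zero_lt_one, Filter.eventually_gt_atTop 0] with R hR hR0
    simp only [Function.comp_apply, one_mul] at hR
    rw [Real.norm_of_nonneg (Real.exp_nonneg _), Real.norm_of_nonneg (by positivity),
      ← Real.rpow_mul hR0.le] at hR
    convert hR using 2
    field_simp
  set c : ℝ := 192 * ((2 * (20000 * 10)) ^ 4 + 8 ^ 4) * (16 * 11 ^ 3) ^ 2 / κ ^ 16 with hc
  filter_upwards [hexp, Filter.eventually_ge_atTop 1,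
    (tendsto_rpow_atTop hδ).eventually_ge_atTop c] with R hE hR hx
  have hR0 : 0 < R := by linarith
  set x := R ^ δ with hxdef
  have hx1 : 1 ≤ x := Real.one_le_rpow hR hδ.le
  have hx0 : 0 < x := by linarith
  have hpow : ∀ (k : ℕ), R ^ ((k : ℝ) * δ) = x ^ k := fun k => by
    rw [hxdef, ← Real.rpow_natCast, ← Real.rpow_mul hR0.le, mul_comm]
  have e1 : R ^ (-(1 / 2) + 2 * δ : ℝ) = R ^ (-(1 / 2) : ℝ) * x ^ 2 := by
    rw [Real.rpow_add hR0, ← hpow 2]; norm_num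
  have e2 : R ^ (20 * δ : ℝ) = x ^ 20 := by rw [← hpow 20]; norm_num
  have e3 : (R ^ (-(1 / 2) : ℝ)) ^ 4 = R ^ (-2 : ℝ) := by
    rw [← Real.rpow_natCast, ← Real.rpow_mul hR0.le]; norm_num
  have e4 : R * (R ^ (-(1 / 2) + δ : ℝ)) ^ 2 / 4 = 1 / 4 * R ^ (2 * δ) := by
    rw [← Real.rpow_natCast, ← Real.rpow_mul hR0.le]
    nth_rewrite 1 [← Real.rpow_one R]
    rw [← Real.rpow_add hR0]
    ring_nf
  have e5 : (Real.pi * R) ^ (3 / 2 : ℝ) ≤ 8 * R ^ (3 / 2 : ℝ) := by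
    rw [Real.mul_rpow Real.pi_pos.le hR0.le]
    gcongr
    calc Real.pi ^ (3 / 2 : ℝ) ≤ 4 ^ (3 / 2 : ℝ) := by
          gcongr; exact Real.pi_lt_four.le
      _ = 8 := by
          rw [show (4 : ℝ) = 2 ^ (2 : ℝ) by norm_num, ← Real.rpow_mul (by norm_num)]; norm_num
  have e6 : R ^ (3 / 2 : ℝ) * R ^ (-2 : ℝ) = R ^ (-(1 / 2) : ℝ) := by
    rw [← Real.rpow_add hR0]; norm_num
  rw [e4, ← neg_mul, e1, e2]
  have hin : (2 * (20000 * (10 * (R ^ (-(1 / 2) : ℝ) * x ^ 2)) / κ ^ 4)) ^ 4 +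
      8 ^ 4 * Real.exp (-(1 / 4) * R ^ (2 * δ)) ≤
      ((2 * (20000 * 10)) ^ 4 + 8 ^ 4) * (x ^ 8 / κ ^ 16) * R ^ (-2 : ℝ) := by
    have k1 : (2 * (20000 * (10 * (R ^ (-(1 / 2) : ℝ) * x ^ 2)) / κ ^ 4)) ^ 4 =
        (2 * (20000 * 10)) ^ 4 * (x ^ 8 / κ ^ 16) * R ^ (-2 : ℝ) := by
      rw [← e3]; field_simp
    have k2 : 1 ≤ x ^ 8 / κ ^ 16 := by
      rw [le_div_iff₀ (by positivity), one_mul]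
      exact (pow_le_one₀ hκ.le hκ1).trans (one_le_pow₀ hx1)
    have k3 : 8 ^ 4 * Real.exp (-(1 / 4) * R ^ (2 * δ)) ≤
        8 ^ 4 * (x ^ 8 / κ ^ 16) * R ^ (-2 : ℝ) := by
      calc _ ≤ 8 ^ 4 * R ^ (-2 : ℝ) := by gcongr
        _ = 8 ^ 4 * 1 * R ^ (-2 : ℝ) := by ring
        _ ≤ _ := by gcongr
    rw [k1]
    linarith
  calc _ ≤ 4 * (3 * (8 * R ^ (3 / 2 : ℝ)) *
        (2 * (((2 * (20000 * 10)) ^ 4 + 8 ^ 4) * (x ^ 8 / κ ^ 16) * R ^ (-2 : ℝ)))) *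
        (16 * (11 * x) ^ 3) ^ 2 := by gcongr
    _ = c * x ^ 14 * (R ^ (3 / 2 : ℝ) * R ^ (-2 : ℝ)) := by rw [hc]; ring
    _ ≤ x ^ 6 * x ^ 14 * R ^ (-(1 / 2) : ℝ) := by
        rw [e6]
        gcongr
        exact hx.trans (le_self_pow₀ hx1 (by norm_num))
    _ = _ := by ring

theorem card_tangTubes_le_pow {γ R δ : ℝ} (hR : 10 ^ 8 ≤ R) (hδ : 0 ≤ δ) (hδ' : δ ≤ 1 / 4)
    (𝕋 : TubeFamily γ R) (P : MvPolynomial (Fin 3) ℝ) (b : E3) :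
    ((tangTubes δ 𝕋 P b).card : ℝ) ≤ R ^ 3 := by
  have hR0 : 0 < R := by linarith
  refine (card_tangTubes_le (by linarith) hδ hδ' 𝕋 P b).trans ?_
  set s := R ^ (1 / 2 : ℝ) with hs
  have hs2 : s ^ 2 = R := by
    rw [hs, ← Real.rpow_natCast, ← Real.rpow_mul hR0.le]; norm_num
  have hs0 : 0 < s := Real.rpow_pos_of_pos hR0 _
  have hs1 : 10 ^ 4 ≤ s := by
    refine le_of_sq_le_sq ?_ hs0.le
    rw [hs2]; linarith
  calc 4 * R * (11 * s) ^ 3 = 5324 * s ^ 5 := by rw [← hs2]; ring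
    _ ≤ s * s ^ 5 := by gcongr; linarith
    _ = R ^ 3 := by rw [← hs2]; ring

theorem volume_smallCube_le {R : ℝ} (hR : 25 ≤ R) (q : E3) :
    volume (smallCube R q) ≤ ENNReal.ofReal (R ^ 2) := by
  have hR0 : 0 < R := by linarith
  have hsub : smallCube R q ⊆ Metric.closedBall q (R ^ (1 / 2 : ℝ)) := fun ξ hξ =>
    dist_center_le_of_mem_smallCube hR0 hξ
  refine (measure_mono hsub).trans ?_
  rw [EuclideanSpace.volume_closedBall_fin_three]
  set s := R ^ (1 / 2 : ℝ) with hs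
  have hs2 : s ^ 2 = R := by
    rw [hs, ← Real.rpow_natCast, ← Real.rpow_mul hR0.le]; norm_num
  have hs0 : 0 < s := Real.rpow_pos_of_pos hR0 _
  have hs1 : 5 ≤ s := by
    refine le_of_sq_le_sq ?_ hs0.le
    rw [hs2]; linarith
  rw [← ENNReal.ofReal_pow hs0.le, ← ENNReal.ofReal_mul (by positivity)]
  apply ENNReal.ofReal_le_ofReal
  have : s ^ 3 * (Real.pi * 4 / 3) ≤ s ^ 3 * s := by
    gcongr
    linarith [Real.pi_lt_d2]
  calc _ ≤ s ^ 3 * s := by linarith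
    _ = _ := by rw [← hs2]; ring

/-- Removing an error term from each factor of a product of squares. -/
theorem sq_mul_sq_le_of_le_add {u₁ u₂ a₁ a₂ e₁ e₂ : ℝ} {L η s₁ s₂ : ℝ} (hu₁ : 0 ≤ u₁) (hu₂ : 0 ≤ u₂)
    (h₁ : u₁ ≤ a₁ + e₁) (h₂ : u₂ ≤ a₂ + e₂) (hs₁ : 0 ≤ s₁) (hs₂ : 0 ≤ s₂) (hη : 0 ≤ η)
    (hηL : η ≤ L)
    (ha₁ : a₁ ^ 2 ≤ L * s₁) (ha₂ : a₂ ^ 2 ≤ L * s₂) (he₁ : e₁ ^ 2 ≤ η * s₁)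
    (he₂ : e₂ ^ 2 ≤ η * s₂) :
    u₁ ^ 2 * u₂ ^ 2 ≤ 4 * (a₁ ^ 2 * a₂ ^ 2) + 12 * (η * L) * (s₁ * s₂) := by
  have k₁ : u₁ ^ 2 ≤ 2 * a₁ ^ 2 + 2 * e₁ ^ 2 := by
    have := pow_le_pow_left₀ hu₁ h₁ 2
    nlinarith [sq_nonneg (a₁ - e₁)]
  have k₂ : u₂ ^ 2 ≤ 2 * a₂ ^ 2 + 2 * e₂ ^ 2 := by
    have := pow_le_pow_left₀ hu₂ h₂ 2
    nlinarith [sq_nonneg (a₂ - e₂)]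
  have m1 : e₁ ^ 2 * a₂ ^ 2 ≤ (η * s₁) * (L * s₂) := mul_le_mul he₁ ha₂ (sq_nonneg _) (by positivity)
  have m2 : a₁ ^ 2 * e₂ ^ 2 ≤ (L * s₁) * (η * s₂) :=
    mul_le_mul ha₁ he₂ (sq_nonneg _) (mul_nonneg (hη.trans hηL) hs₁)
  have m3 : e₁ ^ 2 * e₂ ^ 2 ≤ (η * s₁) * (L * s₂) :=
    mul_le_mul he₁ (he₂.trans (by gcongr)) (sq_nonneg _) (by positivity)
  calc _ ≤ (2 * a₁ ^ 2 + 2 * e₁ ^ 2) * (2 * a₂ ^ 2 + 2 * e₂ ^ 2) := by gcongr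
    _ = 4 * (a₁ ^ 2 * a₂ ^ 2) + 4 * (e₁ ^ 2 * a₂ ^ 2 + a₁ ^ 2 * e₂ ^ 2 + e₁ ^ 2 * e₂ ^ 2) := by ring
    _ ≤ 4 * (a₁ ^ 2 * a₂ ^ 2) + 4 * ((η * s₁) * (L * s₂) + (L * s₁) * (η * s₂) +
        (η * s₁) * (L * s₂)) := by gcongr
    _ = _ := by ring

theorem card_error_bounds {R A N s : ℝ} (hR : 1 ≤ R) (hA : max A 1 ≤ R) (hN0 : 0 ≤ N)
    (hN : N ≤ R ^ 3) (hs : 0 ≤ s) :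
    (N * √(max A 1 * s)) ^ 2 ≤ R ^ 7 * s ∧
      (N * (R ^ (-1000 : ℝ) * √s)) ^ 2 ≤ R ^ (-1994 : ℝ) * s := by
  have hR0 : 0 < R := by linarith
  have hA0 : 0 ≤ max A 1 := zero_le_one.trans (le_max_right _ _)
  have e : R ^ (-1994 : ℝ) = (R ^ 3) ^ 2 * (R ^ (-1000 : ℝ)) ^ 2 := by
    rw [← Real.rpow_natCast (R ^ (-1000 : ℝ)), ← Real.rpow_mul hR0.le, ← pow_mul,
      ← Real.rpow_natCast R, ← Real.rpow_add hR0]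
    norm_num
  rw [mul_pow, mul_pow, mul_pow, Real.sq_sqrt (by positivity), Real.sq_sqrt hs]
  constructor
  · calc _ ≤ (R ^ 3) ^ 2 * (R * s) := by gcongr
      _ = _ := by ring
  · rw [e, mul_assoc]
    gcongr

theorem capParameter_inv_pos_le_one {ε : ℝ} (hε : 0 < ε) :
    0 < (capParameter ε)⁻¹ ∧ (capParameter ε)⁻¹ ≤ 1 := by
  have h1 : 1 ≤ capParameter ε := Real.one_le_exp (by positivity)
  exact ⟨by positivity, inv_le_one_of_one_le₀ h1⟩

theorem eventually_scales {δ κ : ℝ} (hδ' : δ ≤ 1 / 8) (hκ : 0 < κ) :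
    ∀ᶠ R : ℝ in Filter.atTop, 100 * R ^ (-(1 / 2) : ℝ) ≤ κ ∧
      10 * R ^ (-(1 / 2) + 2 * δ : ℝ) ≤ κ ^ 2 / 2000 := by
  have h1 := (tendsto_rpow_neg_atTop (show (0 : ℝ) < 1 / 2 by norm_num)).eventually_le_const
    (show 0 < κ / 100 by positivity)
  have h2 := (tendsto_rpow_neg_atTop (show (0 : ℝ) < 1 / 2 - 2 * δ by linarith)).eventually_le_const
    (show 0 < κ ^ 2 / 20000 by positivity)
  filter_upwards [h1, h2] with R h1 h2
  rw [neg_sub, sub_eq_neg_add] at h2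
  constructor <;> linarith

end SaddleExtension

end

/-! ### Assembly: the bilinear estimate on one cube. -/

theorem mainTheorem6 :
    ∃ C : ℝ, 0 < C ∧ ∀ ε : ℝ, 0 < ε → ε < (10 : ℝ)⁻¹ ^ 10 → ∀ A : ℝ, ∃ R₀ : ℝ, ∀ R : ℝ, R₀ ≤ R →
    ∀ γ : ℝ, γ ∈ Set.Icc (-1 : ℝ) 1 →
    -- the tubes, the polynomial, the ball `B_j` with center `b`, and the cube `Q` with center `q`
    ∀ 𝕋 : SaddleExtension.TubeFamily γ R,
    ∀ P : MvPolynomial (Fin 3) ℝ,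
    SaddleExtension.zeroSet P ⊆ closure (SaddleExtension.nonsingularPoints P) →
    ∀ b q : SaddleExtension.E3,
    (SaddleExtension.smallCube R q ∩
      (SaddleExtension.smallBall R (ε ^ 2) b ∩ SaddleExtension.wall R (ε ^ 2) P)).Nonempty →
    -- two strongly separated caps with centers `c₁`, `c₂` and side lengths `r₁`, `r₂`
    ∀ μ : ℝ, 1 ≤ μ → ∀ (c₁ c₂ : ℝ × ℝ) (r₁ r₂ : ℝ),
    r₁ ∈ Set.Icc (SaddleExtension.capParameter ε)⁻¹
      (μ ^ (1 / 2 : ℝ) * (SaddleExtension.capParameter ε)⁻¹) →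
    r₂ ∈ Set.Icc (SaddleExtension.capParameter ε)⁻¹
      (μ ^ (1 / 2 : ℝ) * (SaddleExtension.capParameter ε)⁻¹) →
    SaddleExtension.StronglySeparated γ μ (SaddleExtension.capParameter ε) c₁ c₂ →
    -- the functions `f_{τ₁}`, `f_{τ₂}` and their wave packets
    ∀ f₁ f₂ : ℝ × ℝ → ℂ,
    MeasureTheory.MemLp f₁ 2 MeasureTheory.volume →
    MeasureTheory.MemLp f₂ 2 MeasureTheory.volume →
    (∀ z ∉ SaddleExtension.cap c₁ r₁, f₁ z = 0) →
    (∀ z ∉ SaddleExtension.cap c₂ r₂, f₂ z = 0) →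
    ∀ g₁ g₂ : SaddleExtension.TubeIndex R → ℝ × ℝ → ℂ,
    SaddleExtension.IsWavePacketDecomposition (ε ^ 2) A 𝕋 f₁ g₁ →
    SaddleExtension.IsWavePacketDecomposition (ε ^ 2) A 𝕋 f₂ g₂ →
      ∫ ξ in SaddleExtension.smallCube R q ∩ SaddleExtension.bigCube R,
          ‖SaddleExtension.extension γ (SaddleExtension.tangPart (ε ^ 2) 𝕋 P b g₁) ξ‖ ^ 2 *
          ‖SaddleExtension.extension γ (SaddleExtension.tangPart (ε ^ 2) 𝕋 P b g₂) ξ‖ ^ 2 ≤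
        R ^ (C * ε ^ 2) * R ^ (-(1 / 2) : ℝ) *
            (∑ T ∈ SaddleExtension.tangTubesAt (ε ^ 2) 𝕋 P b q, SaddleExtension.sqNorm (g₁ T)) *
            (∑ T ∈ SaddleExtension.tangTubesAt (ε ^ 2) 𝕋 P b q, SaddleExtension.sqNorm (g₂ T)) +
          R ^ (-950 : ℝ) * SaddleExtension.sqNorm f₁ * SaddleExtension.sqNorm f₂ := by
  refine ⟨20, by norm_num, fun ε hε hε1 A => ?_⟩
  have hδ : 0 < ε ^ 2 := by positivity
  have hδ8 : ε ^ 2 ≤ 1 / 8 := by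
    have : ε ≤ 1 / 8 := hε1.le.trans (by norm_num)
    nlinarith
  obtain ⟨hκ, hκ1⟩ := SaddleExtension.capParameter_inv_pos_le_one hε
  set κ := (SaddleExtension.capParameter ε)⁻¹ with hκdef
  set δ := ε ^ 2 with hδdef
  obtain ⟨R₀, hR₀⟩ := Filter.eventually_atTop.1
    ((SaddleExtension.eventually_main_constant_le hδ hκ hκ1).and
      ((SaddleExtension.eventually_scales hδ8 hκ).and
        -- `R ≥ max A 1` turns the packet constant into one power of `R`; `R ≥ 10 ^ 8` bounds the
        -- number of tangential tubes by `R ^ 3`.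
        (Filter.eventually_ge_atTop (max (max A 1) (10 ^ 8)))))
  refine ⟨R₀, fun R hR γ hγ 𝕋 P hP b q hQ μ hμ c₁ c₂ r₁ r₂ hr₁ hr₂ hsep f₁ f₂ hf₁ hf₂ hτ₁ hτ₂
    g₁ g₂ hW₁ hW₂ => ?_⟩
  obtain ⟨hmain, ⟨hη, hρκ⟩, hRA⟩ := hR₀ R hR
  have hRA1 : max A 1 ≤ R := (le_max_left _ _).trans hRA
  have hR8 : 10 ^ 8 ≤ R := (le_max_right _ _).trans hRA
  have hR1 : 1 ≤ R := by linarith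
  have hR9 : 9 ≤ R := by linarith
  have hR0 : 0 < R := by linarith
  obtain ⟨n, hn, hnT⟩ := SaddleExtension.exists_common_normal (γ := γ) hR1 hδ.le
    (by linarith) hP hQ
  set F₁ := SaddleExtension.contributingPart δ 𝕋 P b q (SaddleExtension.cap c₁ r₁) g₁ with hF₁
  set F₂ := SaddleExtension.contributingPart δ 𝕋 P b q (SaddleExtension.cap c₂ r₂) g₂ with hF₂
  obtain ⟨hint, hbil⟩ := SaddleExtension.integral_extension_mul_sq_le (γ := γ)
    (r := 20000 * (10 * R ^ (-(1 / 2) + 2 * δ : ℝ)) / κ ^ 4) (d := R ^ (-(1 / 2) + δ : ℝ))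
    hR0 (by positivity) (by positivity) (F₁ := F₁) (F₂ := F₂) hW₁.memLp_contributingPart
    hW₂.memLp_contributingPart (hW₁.integrable_contributingPart hR9)
    (hW₂.integrable_contributingPart hR9)
    (fun w w' => SaddleExtension.contributing_separation (abs_le.2 hγ) hδ.le hR1 hκ hκ1 hμ hη hρκ
      hr₁.2 hr₂.2 hsep hn hnT hW₁ hW₂ w w') q
  set S₁ := ∑ T ∈ SaddleExtension.tangTubesAt δ 𝕋 P b q, SaddleExtension.sqNorm (g₁ T)
  set S₂ := ∑ T ∈ SaddleExtension.tangTubesAt δ 𝕋 P b q, SaddleExtension.sqNorm (g₂ T)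
  have hS₁ : SaddleExtension.sqNorm F₁ ≤ 16 * (11 * R ^ δ) ^ 3 * S₁ :=
    hW₁.sqNorm_contributingPart_le hR1 hδ.le
  have hS₂ : SaddleExtension.sqNorm F₂ ≤ 16 * (11 * R ^ δ) ^ 3 * S₂ :=
    hW₂.sqNorm_contributingPart_le hR1 hδ.le
  have hS₁0 : 0 ≤ S₁ := Finset.sum_nonneg fun _ _ => SaddleExtension.sqNorm_nonneg _
  have hS₂0 : 0 ≤ S₂ := Finset.sum_nonneg fun _ _ => SaddleExtension.sqNorm_nonneg _
  have hs₁ := SaddleExtension.sqNorm_nonneg f₁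
  have hs₂ := SaddleExtension.sqNorm_nonneg f₂
  -- `R ^ 7` and `R ^ (-1994)` bound the squares of the main and error terms relative to `‖f_i‖²`;
  -- the three products involving an error, each with coefficient 4, give 12.
  set E := 12 * (R ^ (-1994 : ℝ) * R ^ 7) *
    (SaddleExtension.sqNorm f₁ * SaddleExtension.sqNorm f₂) with hE
  have hE0 : 0 ≤ E := by positivity
  set D := SaddleExtension.smallCube R q ∩ SaddleExtension.bigCube R with hD
  have hDvol : MeasureTheory.volume D ≤ ENNReal.ofReal (R ^ 2) :=
    (MeasureTheory.measure_mono Set.inter_subset_left).trans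
      (SaddleExtension.volume_smallCube_le (by linarith) q)
  have hDtop : MeasureTheory.volume D ≠ ⊤ := ne_top_of_le_ne_top ENNReal.ofReal_ne_top hDvol
  have hDm : MeasurableSet D := by
    have e : D = (⋂ i, {ξ : SaddleExtension.E3 | |ξ i - q i| ≤ R ^ (1 / 2 : ℝ) / 2}) ∩
        ⋂ i, {ξ : SaddleExtension.E3 | |ξ i| ≤ R} := by
      ext; simp [hD, SaddleExtension.smallCube, SaddleExtension.bigCube]
    rw [e]
    exact (MeasurableSet.iInter fun i =>
      (isClosed_le (by fun_prop) (by fun_prop)).measurableSet).inter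
      (MeasurableSet.iInter fun i => (isClosed_le (by fun_prop) (by fun_prop)).measurableSet)
  have hcard := SaddleExtension.card_tangTubes_le_pow hR8 hδ.le (by linarith) 𝕋 P b
  have hpt : ∀ ξ ∈ D,
      ‖SaddleExtension.extension γ (SaddleExtension.tangPart δ 𝕋 P b g₁) ξ‖ ^ 2 *
        ‖SaddleExtension.extension γ (SaddleExtension.tangPart δ 𝕋 P b g₂) ξ‖ ^ 2 ≤
      4 * (‖SaddleExtension.extension γ F₁ ξ‖ ^ 2 * ‖SaddleExtension.extension γ F₂ ξ‖ ^ 2) + E := by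
    intro ξ hξ
    have b₁ := SaddleExtension.card_error_bounds hR1 hRA1 (Nat.cast_nonneg _) hcard hs₁
    have b₂ := SaddleExtension.card_error_bounds hR1 hRA1 (Nat.cast_nonneg _) hcard hs₂
    refine SaddleExtension.sq_mul_sq_le_of_le_add (norm_nonneg _) (norm_nonneg _)
      (hW₁.norm_extension_tangPart_le hR9 hτ₁ hξ) (hW₂.norm_extension_tangPart_le hR9 hτ₂ hξ)
      hs₁ hs₂ (by positivity) ?_
      ((pow_le_pow_left₀ (norm_nonneg _)
        (hW₁.norm_extension_contributingPart_le hR9 hf₁ ξ) 2).trans b₁.1)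
      ((pow_le_pow_left₀ (norm_nonneg _)
        (hW₂.norm_extension_contributingPart_le hR9 hf₂ ξ) 2).trans b₂.1) b₁.2 b₂.2
    exact (Real.rpow_le_one_of_one_le_of_nonpos hR1 (by norm_num)).trans (one_le_pow₀ hR1)
  have hintD := hint.mono_set (Set.inter_subset_left : D ⊆ SaddleExtension.smallCube R q)
  have hconst : MeasureTheory.IntegrableOn (fun _ : SaddleExtension.E3 => E) D :=
    MeasureTheory.integrableOn_const hDtop
  -- The cube has volume at most `R ^ 2` and 12 costs one more power of `R`, so the exponent is
  -- `-1994 + 7 + 2 + 1 = -1984`.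
  have herr : E * R ^ 2 ≤
      R ^ (-950 : ℝ) * SaddleExtension.sqNorm f₁ * SaddleExtension.sqNorm f₂ := by
    have h1 : 12 * (R ^ (-1994 : ℝ) * R ^ 7) * R ^ 2 ≤ R ^ (-950 : ℝ) := by
      calc 12 * (R ^ (-1994 : ℝ) * R ^ 7) * R ^ 2 ≤ R * (R ^ (-1994 : ℝ) * R ^ 7) * R ^ 2 := by
            gcongr; linarith
        _ = R ^ (-1994 : ℝ) * R ^ 10 := by ring
        _ = R ^ (-1984 : ℝ) := by
            rw [← Real.rpow_natCast R, ← Real.rpow_add hR0]; norm_num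
        _ ≤ _ := Real.rpow_le_rpow_of_exponent_le hR1 (by norm_num)
    calc E * R ^ 2 = 12 * (R ^ (-1994 : ℝ) * R ^ 7) * R ^ 2 *
          (SaddleExtension.sqNorm f₁ * SaddleExtension.sqNorm f₂) := by rw [hE]; ring
      _ ≤ R ^ (-950 : ℝ) * (SaddleExtension.sqNorm f₁ * SaddleExtension.sqNorm f₂) := by gcongr
      _ = _ := by ring
  calc _ ≤ ∫ ξ in D, (4 * (‖SaddleExtension.extension γ F₁ ξ‖ ^ 2 *
          ‖SaddleExtension.extension γ F₂ ξ‖ ^ 2) + E) :=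
        MeasureTheory.integral_mono_of_nonneg
          (Filter.Eventually.of_forall fun _ => by positivity)
          ((hintD.const_mul 4).add hconst)
          ((MeasureTheory.ae_restrict_iff' hDm).2 (Filter.Eventually.of_forall hpt))
    _ = 4 * (∫ ξ in D, ‖SaddleExtension.extension γ F₁ ξ‖ ^ 2 *
          ‖SaddleExtension.extension γ F₂ ξ‖ ^ 2) + (MeasureTheory.volume D).toReal * E := by
        rw [MeasureTheory.integral_add (hintD.const_mul 4) hconst,
          MeasureTheory.integral_const_mul, MeasureTheory.setIntegral_const, smul_eq_mul]
        rfl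
    _ ≤ 4 * (∫ ξ in SaddleExtension.smallCube R q, ‖SaddleExtension.extension γ F₁ ξ‖ ^ 2 *
          ‖SaddleExtension.extension γ F₂ ξ‖ ^ 2) + R ^ 2 * E := by
        refine add_le_add (mul_le_mul_of_nonneg_left ?_ (by norm_num))
          (mul_le_mul_of_nonneg_right ?_ hE0)
        · exact MeasureTheory.setIntegral_mono_set hint
            (Filter.Eventually.of_forall fun _ => by positivity)
            (Filter.Eventually.of_forall fun _ h => h.1)
        · exact ENNReal.toReal_le_of_le_ofReal (by positivity) hDvol
    _ ≤ R ^ (20 * δ) * R ^ (-(1 / 2) : ℝ) * S₁ * S₂ + R ^ 2 * E := by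
        refine add_le_add ?_ le_rfl
        calc _ ≤ 4 * (3 * (Real.pi * R) ^ (3 / 2 : ℝ) *
              (2 * ((2 * (20000 * (10 * R ^ (-(1 / 2) + 2 * δ : ℝ)) / κ ^ 4)) ^ 4 +
                8 ^ 4 * Real.exp (-(R * (R ^ (-(1 / 2) + δ : ℝ)) ^ 2 / 4)))) *
              ((16 * (11 * R ^ δ) ^ 3 * S₁) * (16 * (11 * R ^ δ) ^ 3 * S₂))) := by
              refine mul_le_mul_of_nonneg_left (hbil.trans (mul_le_mul_of_nonneg_left
                (mul_le_mul hS₁ hS₂ (SaddleExtension.sqNorm_nonneg _) (by positivity)) ?_))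
                (by norm_num)
              positivity
          _ = (4 * (3 * (Real.pi * R) ^ (3 / 2 : ℝ) *
              (2 * ((2 * (20000 * (10 * R ^ (-(1 / 2) + 2 * δ : ℝ)) / κ ^ 4)) ^ 4 +
                8 ^ 4 * Real.exp (-(R * (R ^ (-(1 / 2) + δ : ℝ)) ^ 2 / 4))))) *
              (16 * (11 * R ^ δ) ^ 3) ^ 2) * (S₁ * S₂) := by ring
          _ ≤ (R ^ (20 * δ) * R ^ (-(1 / 2) : ℝ)) * (S₁ * S₂) := by gcongr
          _ = _ := by ring
    _ ≤ _ := by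
        rw [mul_comm (R ^ 2)]
        gcongr
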